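/- **Setting.** A transition system $TS=(S,\to,s_0,B)$ consists of a finite state set $S$ with $n=|S|$, a relation $\to$ on $S$, an initial state $s_0\in S$ and a set $B\subseteq S$ of bad states. A run is an infinite sequence of states that starts in $s_0$ and follows $\to$. A counterexample is a sequence $\rho=\rho_0\dots\rho_k$ of pairwise distinct states that is a prefix of a run and satisfies $\rho_k\in B$ and $\rho_i\notin B$ for $i<k$. For $D\subseteq S$ let $\mathcal G_D$ be the following safety game from $s_0$. Player Safe controls the states in $D$ and player Reach the other states. A state that lies on $\rho$ and not in $D$ keeps only the transition $\rho_i\to\rho_{i+1}$ that follows $\rho$ (so $\rho_k$ has none if $\rho_k\notin D$), and every other state keeps its transitions of $TS$. A (positional) strategy of a player chooses a successor at each of the player's states that has one. A play that arrives at a state without successors stops there. Safe wins $\mathcal G_D$ if she has a strategy such that, for every strategy of Reach, the induced play visits no bad state. The optimistic cooperative game is $v_{\mathrm{opt}}(C)=1$ if Safe wins $\mathcal G_{C\cup(S\setminus\{\rho_0,\dots,\rho_k\})}$, and $v_{\mathrm{opt}}(C)=0$ otherwise, for $C\subseteq S$. A general power index $\mathcal R$ on $S$ is given by a weight vector $(p_0,\dots,p_{n-1})$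 with $\sum_{k=0}^{n-1}\binom{n-1}{k}p_k=1$, through $$\mathcal R(v,s)=\sum_{C\subseteq S\setminus\{s\}}p_{|C|}\,\bigl(v(C\cup\{s\})-v(C)\bigr).$$ The optimistic responsibility of $s\in S$ is $\mathcal R(v_{\mathrm{opt}},s)$. Inputs consist of $TS$ with $S=\{0,\dots,n-1\}$ (the relation given by its adjacency matrix, the bad states by their indicator vector), a counterexample $\rho$, a state $s$, and $\mathcal R$ given by rational weights $p_0,\dots,p_{n-1}$. Integers are written in binary, and rational numbers as fractions of integers that need not be in lowest terms. **Theorem.** The following three problems are solvable by Turing machines in time polynomial in the length of the input. 1. (Optimistic positivity) Given $TS,\rho,s,\mathcal R$, decide whether $\mathcal R(v_{\mathrm{opt}},s)>0$. 2. (Optimistic threshold) Given $TS,\rho,s,\mathcal R$ and a rational $t\in[0,1)$, decide whether $\mathcal R(v_{\mathrm{opt}},s)>t$. 3. (Optimistic computation) Given $TS,\rho,s,\mathcal R$, output the value $\mathcal R(v_{\mathrm{opt}},s)$ as a fraction of two integers. -/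

import Mathlib

/-! ### Transition systems and counterexamples -/

/-- A transition system with state set `S` (assumed finite where it matters). -/
structure TransitionSystem (S : Type*) where
  trans : S → S → Prop
  init : S
  bad : Set S

/-- A run: an infinite sequence of states that starts in the initial state and follows
the transition relation. -/
def TransitionSystem.IsRun {S : Type*} (TS : TransitionSystem S) (r : ℕ → S) : Prop :=
  r 0 = TS.init ∧ ∀ i, TS.trans (r i) (r (i + 1))

/-- A counterexample `ρ₀ … ρₖ`: a loop-free prefix of a run whose last state is its only
bad state. -/
structure TransitionSystem.IsCounterexample {S : Type*} (TS : TransitionSystem S)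
    (ρ : List S) : Prop where
  ne_nil : ρ ≠ []
  prefix_of_run : ∃ r : ℕ → S, TS.IsRun r ∧ ∀ (i : ℕ) (hi : i < ρ.length), ρ[i] = r i
  last_bad : ρ.getLast ne_nil ∈ TS.bad
  not_bad_before : ∀ (i : ℕ) (hi : i + 1 < ρ.length), ρ[i] ∉ TS.bad
  nodup : ρ.Nodup

/-! ### Safety games -/

/-- A safety game. The states in `safe` are controlled by Safe, all others by Reach. -/
structure SafetyGame (S : Type*) where
  safe : Set S
  trans : S → S → Prop
  init : S
  bad : Set S

namespace SafetyGame

variable {S : Type*}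

/-- `σ` is a (positional) strategy for Safe: it chooses a successor at every state of Safe
that has one. The values of `σ` at other states play no role. -/
def IsSafeStrategy (G : SafetyGame S) (σ : S → S) : Prop :=
  ∀ s, s ∈ G.safe → (∃ s', G.trans s s') → G.trans s (σ s)

/-- `τ` is a (positional) strategy for Reach: it chooses a successor at every state of Reach
that has one. The values of `τ` at other states play no role. -/
def IsReachStrategy (G : SafetyGame S) (τ : S → S) : Prop :=
  ∀ s, s ∉ G.safe → (∃ s', G.trans s s') → G.trans s (τ s)

open Classical in
/-- The play induced by a strategy `σ` of Safe and a strategy `τ` of Reach. A play that arrives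
at a state without successors stops, which is represented by staying there forever. -/
noncomputable def play (G : SafetyGame S) (σ τ : S → S) : ℕ → S
  | 0 => G.init
  | i + 1 =>
    if ∃ s', G.trans (G.play σ τ i) s' then
      if G.play σ τ i ∈ G.safe then σ (G.play σ τ i) else τ (G.play σ τ i)
    else G.play σ τ i

/-- Safe wins the game: she has a strategy such that, against every strategy of Reach,
the induced play visits no bad state. -/
def SafeWins (G : SafetyGame S) : Prop :=
  ∃ σ, G.IsSafeStrategy σ ∧ ∀ τ, G.IsReachStrategy τ → ∀ i, G.play σ τ i ∉ G.bad

end SafetyGame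

namespace TransitionSystem

variable {S : Type*}

/-- The safety game in which Safe controls `C` and the counterexample `ρ` is engraved: a state
of `ρ` outside `C` keeps only the transition that follows `ρ`. -/
def engravedGame (TS : TransitionSystem S) (ρ : List S) (C : Set S) : SafetyGame S where
  safe := C
  trans s s' :=
    (s ∉ C ∧ ∃ (i : ℕ) (hi : i + 1 < ρ.length), s = ρ[i] ∧ s' = ρ[i + 1]) ∨
      (TS.trans s s' ∧ (s ∉ ρ ∨ s ∈ C))
  init := TS.init
  bad := TS.bad

open Classical in
/-- The optimistic cooperative game: the gain of `C` is `1` if Safe wins the engraved game in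
which she controls `C` and all states that do not lie on `ρ`, and `0` otherwise. -/
noncomputable def optimisticGame (TS : TransitionSystem S) (ρ : List S) (C : Finset S) : ℝ :=
  if (TS.engravedGame ρ ((C : Set S) ∪ {s | s ∉ ρ})).SafeWins then 1 else 0

end TransitionSystem

/-! ### General power indices -/

/-- Weight vectors `(p₀, …, pₙ₋₁)`. -/
def IsWeightVector {n : ℕ} (p : Fin n → ℝ) : Prop :=
  ∑ k : Fin n, ((n - 1).choose k : ℝ) * p k = 1

/-- The general power index with weights `p` on the set `X` of players: the sum of
`p_{|C|} * (v (C ∪ {i}) - v C)` over all coalitions `C` that do not contain `i`. -/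
noncomputable def powerIndex {X : Type*} [Fintype X] [DecidableEq X]
    (p : Fin (Fintype.card X) → ℝ) (v : Finset X → ℝ) (i : X) : ℝ :=
  ∑ C : {C : Finset X // i ∉ C},
    p ⟨C.1.card, Finset.card_lt_univ_of_notMem C.2⟩ * (v (insert i C.1) - v C.1)

/-! ### Instances of the computational problems and their encodings -/

/-- A rational number in the form `num / den`, not necessarily in lowest terms. -/
structure Fraction where
  num : ℤ
  den : ℕ
  den_ne_zero : den ≠ 0

noncomputable def Fraction.toReal (q : Fraction) : ℝ := (q.num : ℝ) / (q.den : ℝ)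

/-- A natural number in binary (least significant bit first), ended by a comma. -/
def encNat (m : ℕ) : List Computability.Γ' :=
  (Computability.encodeNat m).map Computability.Γ'.bit ++ [Computability.Γ'.comma]

/-- A fraction: a sign bit, the absolute value of the numerator, the denominator. -/
def Fraction.encode (q : Fraction) : List Computability.Γ' :=
  Computability.Γ'.bit (decide (q.num < 0)) :: (encNat q.num.natAbs ++ encNat q.den)

/-- An input of the positivity and of the computation problem: a transition system with states
`0, …, n - 1`, a counterexample, a state, and a general power index given by its weights. -/
structure ResponsibilityInput where
  n : ℕ
  ts : TransitionSystem (Fin n)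
  ce : List (Fin n)
  isCounterexample : ts.IsCounterexample ce
  state : Fin n
  weight : Fin n → Fraction
  isWeightVector : IsWeightVector (fun k => (weight k).toReal)

namespace ResponsibilityInput

/-- The optimistic responsibility of the state in question. -/
noncomputable def optimisticResponsibility (x : ResponsibilityInput) : ℝ :=
  powerIndex (fun k => (x.weight (Fin.cast (Fintype.card_fin x.n) k)).toReal)
    (x.ts.optimisticGame x.ce) x.state

open Classical in
/-- The input string: the number of states, the rows of the adjacency matrix, the initial state,
the indicator vector of the bad states, the counterexample, the state, the weights. -/
noncomputable def encode (x : ResponsibilityInput) : List Computability.Γ' :=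
  encNat x.n ++
    (List.finRange x.n).flatMap (fun i =>
      (List.finRange x.n).map (fun j => Computability.Γ'.bit (decide (x.ts.trans i j))) ++
        [Computability.Γ'.comma]) ++
    encNat x.ts.init ++
    ((List.finRange x.n).map (fun i => Computability.Γ'.bit (decide (i ∈ x.ts.bad))) ++
      [Computability.Γ'.comma]) ++
    (Computability.Γ'.bra :: x.ce.flatMap (fun i => encNat i) ++ [Computability.Γ'.ket]) ++
    encNat x.state ++
    (List.finRange x.n).flatMap (fun k => (x.weight k).encode)

end ResponsibilityInput

/-- An input of the threshold problem: additionally a threshold `t` in `[0, 1)`. -/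
structure ThresholdInput extends ResponsibilityInput where
  t : Fraction
  t_nonneg : 0 ≤ t.toReal
  t_lt_one : t.toReal < 1

noncomputable def ThresholdInput.encode (x : ThresholdInput) : List Computability.Γ' :=
  x.toResponsibilityInput.encode ++ x.t.encode

/-! ### Polynomial time -/

/-- `f` is computed by a Turing machine in time polynomial in the length of the input string. -/
def PolyTimeComputable {α β A B : Type} (ea : α → List A) (eb : β → List B) (f : α → β) : Prop :=
  Nonempty (Turing.TM2ComputableInPolyTime ea eb f)

open Classical in
/-- `P` is decided by a Turing machine in time polynomial in the length of the input string. -/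
def PolyTimeDecidable {α A : Type} (ea : α → List A) (P : α → Prop) : Prop :=
  PolyTimeComputable ea Computability.encodeBool (fun x => decide (P x))

/-! In the game for a coalition C, every state of Reach lies on ρ outside C and keeps at most one
transition, because the states of ρ are distinct. Reach never has a real choice. So Safe wins
exactly if the initial state lies in a set of non-bad states each of which, if it has a successor at
all, has one inside the set (`IsCounterexample.safeWins_iff`).

The decisive point is `IsCounterexample.exists_safeRegion_singleton`. The last state of ρ in such a
set must belong to C, since otherwise the engraved transition would lead to a later state of ρ in
the set. This state already wins alone: follow ρ up to it, then stay in the set. Conversely, more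
control never hurts (`IsCounterexample.isSafeRegion_mono`). Hence the cooperative game is a
disjunction: C has value 1 iff it meets the set W of states that win alone. A state outside W has
responsibility 0. A state of W contributes to exactly the coalitions disjoint from W, so with m = |S
\ W| its responsibility is ∑ₖ (m choose k) pₖ (`powerIndex_of_disjunction`). The exponential sum is
gone.

Membership in W is a greatest fixed point, reached from the set of all states after n rounds. The
binomial sum is computed by m rounds of Pascal's rule over the product of all denominators. Weights
of different sign are summed separately, so that all arithmetic is on natural numbers and the
decision problems become comparisons (`ResponsibilityInput.part_tokens`).

For the running time, a structured stack language is compiled to `TM2` machines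
(`Prog.exec_compile`). Its data are prefix codes of binary trees on one working stack. `PolyTime`
quantifies over the rest of that stack, so programs compose. The class is closed under composition,
pairing, case distinction, and those iterations and folds whose intermediate values stay
polynomially bounded. These closure lemmas are registered with `fun_prop`, which then treats most of
the algorithm after unfolding. Indices are unary, the numbers of the arithmetic binary. The
mathematical content left over is the growth bounds of the loops. -/

/-! ### A structured stack language and its compilation to `TM2` machines -/

/-- The stacks of the machines: the input, two outputs (one for each output alphabet),
a working stack, and three auxiliary stacks. -/
inductive Tape
  | inp | outSym | outBool | main | aux₁ | aux₂ | depth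
  deriving DecidableEq

instance : Fintype Tape :=
  ⟨{.inp, .outSym, .outBool, .main, .aux₁, .aux₂, .depth}, fun k => by cases k <;> decide⟩

/-- The alphabet of a stack. -/
def Tape.Sym : Tape → Type
  | inp => Computability.Γ'
  | outSym => Computability.Γ'
  | _ => Bool

noncomputable instance (k : Tape) : Fintype k.Sym :=
  match k with
  | .inp => inferInstanceAs (Fintype Computability.Γ')
  | .outSym => inferInstanceAs (Fintype Computability.Γ')
  | .outBool => inferInstanceAs (Fintype Bool)
  | .main => inferInstanceAs (Fintype Bool)
  | .aux₁ => inferInstanceAs (Fintype Bool)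
  | .aux₂ => inferInstanceAs (Fintype Bool)
  | .depth => inferInstanceAs (Fintype Bool)

/-- The contents of all stacks. -/
abbrev Tapes : Type := (k : Tape) → List k.Sym

/-- Structured programs. `popCase k f` pops the stack `k` and continues according to the result;
`loop k c f` does so repeatedly, until `c` fails for the result. -/
inductive Prog : Type
  | skip : Prog
  | push (k : Tape) (a : k.Sym) : Prog
  | seq (p q : Prog) : Prog
  | popCase (k : Tape) (f : Option k.Sym → Prog) : Prog
  | loop (k : Tape) (c : Option k.Sym → Bool) (f : Option k.Sym → Prog) : Prog

namespace Prog

open Function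

/-- `Exec p S S' t`: the program `p` turns the stacks `S` into `S'` in `t` steps. -/
inductive Exec : Prog → Tapes → Tapes → ℕ → Prop
  | skip (S) : Exec skip S S 1
  | push (k a S) : Exec (push k a) S (update S k (a :: S k)) 1
  | seq {p q S S' S'' t t'} : Exec p S S' t → Exec q S' S'' t' → Exec (seq p q) S S'' (t + t')
  | popCase {k f S S' t} : Exec (f (S k).head?) (update S k (S k).tail) S' t →
      Exec (popCase k f) S S' (t + 1)
  | loop_exit {k c f S} : c (S k).head? = false →
      Exec (loop k c f) S (update S k (S k).tail) 1
  | loop_step {k c f S S' S'' t t'} : c (S k).head? = true →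
      Exec (f (S k).head?) (update S k (S k).tail) S' t →
      Exec (loop k c f) S' S'' t' → Exec (loop k c f) S S'' (t + t' + 1)

/-- The labels of the machine for a program. -/
def Label : Prog → Type
  | skip => Unit
  | push _ _ => Unit
  | seq p q => p.Label ⊕ q.Label
  | popCase _ f => Option (Σ o, (f o).Label)
  | loop _ _ f => Option (Σ o, (f o).Label)

noncomputable instance fintypeLabel : (p : Prog) → Fintype p.Label
  | skip => inferInstanceAs (Fintype Unit)
  | push _ _ => inferInstanceAs (Fintype Unit)
  | seq p q =>
    have := fintypeLabel p
    have := fintypeLabel q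
    inferInstanceAs (Fintype (p.Label ⊕ q.Label))
  | popCase _ f =>
    have := fun o => fintypeLabel (f o)
    inferInstanceAs (Fintype (Option (Σ o, (f o).Label)))
  | loop _ _ f =>
    have := fun o => fintypeLabel (f o)
    inferInstanceAs (Fintype (Option (Σ o, (f o).Label)))

/-- The label at which a program starts. -/
def entry : (p : Prog) → p.Label
  | skip => ()
  | push _ _ => ()
  | seq p _ => Sum.inl p.entry
  | popCase _ _ => (none : Option _)
  | loop _ _ _ => (none : Option _)

/-- The internal memory of the machines: the last symbol popped from each stack. -/
abbrev Mem : Type := (k : Tape) → Option k.Sym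

/-- The machine code for a program whose labels are embedded by `inj`, and which jumps to `exit`
at its end. -/
def compile {L : Type} : (p : Prog) → (p.Label → L) → L → p.Label →
    Turing.TM2.Stmt Tape.Sym L Mem
  | skip, _, exit, _ => .goto fun _ => exit
  | push k a, _, exit, _ => .push k (fun _ => a) (.goto fun _ => exit)
  | seq p q, inj, exit, l =>
    Sum.elim (p.compile (fun l => inj (Sum.inl l)) (inj (Sum.inr q.entry)))
      (q.compile (fun l => inj (Sum.inr l)) exit) l
  | popCase k f, inj, exit, l =>
    Option.elim l
      (.pop k (fun v o => update v k o) (.goto fun v => inj (some ⟨v k, (f (v k)).entry⟩)))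
      fun l => (f l.1).compile (fun l' => inj (some ⟨l.1, l'⟩)) exit l.2
  | loop k c f, inj, exit, l =>
    Option.elim l
      (.pop k (fun v o => update v k o)
        (.goto fun v => bif c (v k) then inj (some ⟨v k, (f (v k)).entry⟩) else exit))
      fun l => (f l.1).compile (fun l' => inj (some ⟨l.1, l'⟩)) (inj none) l.2

/-- Induction on the execution. Generality in `inj` and `exit` makes it work: a subprogram sits in
the larger machine with its own labels embedded and its own place to continue. The final memory is
existential because popped symbols are left behind in it. -/
theorem exec_compile {L : Type} (M : L → Turing.TM2.Stmt Tape.Sym L Mem) {p : Prog}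
    {S S' : Tapes} {t : ℕ} (h : Exec p S S' t) :
    ∀ (inj : p.Label → L) (exit : L), (∀ l, M (inj l) = p.compile inj exit l) →
      ∀ v : Mem, ∃ v' : Mem,
        (flip bind (Turing.TM2.step M))^[t] (some ⟨some (inj p.entry), v, S⟩) =
          some ⟨some exit, v', S'⟩ := by
  have one (l : L) (v : Mem) (S : Tapes) : (flip bind (Turing.TM2.step M)) (some ⟨some l, v, S⟩) =
      some (Turing.TM2.stepAux (M l) v S) := rfl
  induction h with
  | skip S =>
    exact fun inj exit hM v => ⟨v, by rw [iterate_one, one, hM]; rfl⟩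
  | push k a S =>
    exact fun inj exit hM v => ⟨v, by rw [iterate_one, one, hM]; rfl⟩
  | @seq p q S S' S'' t t' _ _ ihp ihq =>
    intro inj exit hM v
    obtain ⟨v₁, h₁⟩ := ihp (fun l => inj (Sum.inl l)) (inj (Sum.inr q.entry))
      (fun l => hM (Sum.inl l)) v
    obtain ⟨v₂, h₂⟩ := ihq (fun l => inj (Sum.inr l)) exit (fun l => hM (Sum.inr l)) v₁
    refine ⟨v₂, ?_⟩
    rw [add_comm, iterate_add_apply]
    exact (congrArg _ h₁).trans h₂
  | @popCase k f S S' t _ ih =>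
    intro inj exit hM v
    obtain ⟨v', h'⟩ := ih (fun l => inj (some ⟨(S k).head?, l⟩)) exit
      (fun l => hM (some ⟨_, l⟩)) (update v k (S k).head?)
    refine ⟨v', ?_⟩
    rw [iterate_succ_apply, one, ← h', hM]
    refine congrArg _ (congrArg some ?_)
    -- The popped symbol occurs in the type of the next label, so it is abstracted before the memory
    -- lookup is rewritten.
    change (⟨some ((fun o => inj (some ⟨o, (f o).entry⟩)) (update v k (S k).head? k)), _, _⟩ :
      Turing.TM2.Cfg Tape.Sym L Mem) = _
    rw [update_self]
  | @loop_exit k c f S hc =>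
    intro inj exit hM v
    refine ⟨update v k (S k).head?, ?_⟩
    rw [iterate_one, one, hM]
    simp [compile, entry, Turing.TM2.stepAux, hc]
  | @loop_step k c f S S' S'' t t' hc _ _ ih₁ ih₂ =>
    intro inj exit hM v
    obtain ⟨v₁, h₁⟩ := ih₁ (fun l => inj (some ⟨(S k).head?, l⟩)) (inj none)
      (fun l => hM (some ⟨_, l⟩)) (update v k (S k).head?)
    obtain ⟨v₂, h₂⟩ := ih₂ inj exit hM v₁
    refine ⟨v₂, ?_⟩
    rw [iterate_succ_apply, add_comm, iterate_add_apply, ← h₂, one, hM]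
    refine congrArg _ (Eq.trans ?_ h₁)
    refine congrArg _ (congrArg some ?_)
    change (⟨some ((fun o => bif c o then inj (some ⟨o, (f o).entry⟩) else exit)
      (update v k (S k).head? k)), _, _⟩ : Turing.TM2.Cfg Tape.Sym L Mem) = _
    rw [update_self]
    simp [hc]

/-- The stacks that hold `inp`, `outSym`, `outBool`, `main`, `aux₁`, `aux₂`, `depth`. -/
def tapes (i o : List Computability.Γ') (b m a₁ a₂ d : List Bool) : Tapes
  | .inp => i
  | .outSym => o
  | .outBool => b
  | .main => m
  | .aux₁ => a₁
  | .aux₂ => a₂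
  | .depth => d

/-- The machine that runs `p` and halts. -/
noncomputable def machine (p : Prog) (k₁ : Tape) : Turing.FinTM2 where
  K := Tape
  k₀ := .inp
  k₁ := k₁
  Γ := Tape.Sym
  Λ := Option p.Label
  main := some p.entry
  σ := Mem
  initialState := fun _ => none
  m
    | none => .load (fun _ _ => none) .halt
    | some l => p.compile some none l

/-- The additional step is the halting label. It clears the memory, since the prescribed final
configuration has the initial memory and all stacks empty except the output. -/
theorem machine_outputs {p : Prog} {k₁ : Tape} {S S' : Tapes} {t m : ℕ} (h : Exec p S S' t)
    {l : List Computability.Γ'} {l' : List k₁.Sym} (hS : S = tapes l [] [] [] [] [] [])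
    (hS' : S' = update (fun _ => []) k₁ l') (hm : t + 1 ≤ m) :
    Nonempty (Turing.TM2OutputsInTime (p.machine k₁) l (some l') m) := by
  obtain ⟨v, hv⟩ := exec_compile (p.machine k₁).m h some none (fun _ => rfl) (fun _ => none)
  refine ⟨⟨⟨t + 1, ?_⟩, hm⟩⟩
  have hinit : Turing.initList (p.machine k₁) l = ⟨some (some p.entry), fun _ => none, S⟩ := by
    subst hS
    unfold Turing.initList
    congr 1
    funext k
    cases k <;> rfl
  have hhalt : some (⟨none, fun _ => none, S'⟩ : (p.machine k₁).Cfg) =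
      some (Turing.haltList (p.machine k₁) l') := by
    unfold Turing.haltList
    subst hS'
    congr 2
    funext k
    by_cases hk : k = k₁
    · subst hk
      refine (update_self (β := fun k => List k.Sym) k l' _).trans (Eq.symm ?_)
      apply dif_pos
      rfl
    · refine (update_of_ne (β := fun k => List k.Sym) hk _ _).trans (Eq.symm ?_)
      apply dif_neg
      exact hk
  rw [add_comm, iterate_add_apply]
  exact ((congrArg _ (congrArg _ (congrArg some hinit))).trans (congrArg _ hv)).trans hhalt

end Prog

/-! ### Binary trees as data, and polynomial-time functions -/

/-- Binary trees, the data on which the programs work. -/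
inductive BinTree
  | nil : BinTree
  | cons (l r : BinTree) : BinTree

/-- The prefix code of a tree. -/
def BinTree.code : BinTree → List Bool
  | nil => [false]
  | cons l r => true :: (l.code ++ r.code)

/-- Types whose elements are represented by trees. -/
class TreeCode (α : Type) where
  toTree : α → BinTree

namespace TreeCode

variable {α β : Type} [TreeCode α] [TreeCode β]

/-- The representation of `a` on a stack. -/
def code (a : α) : List Bool := (toTree a).code

/-- The length of the representation. -/
def size (a : α) : ℕ := (code a).length

instance : TreeCode Unit := ⟨fun _ => .nil⟩

instance : TreeCode Bool := ⟨fun b => bif b then .cons .nil .nil else .nil⟩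

instance : TreeCode (α × β) := ⟨fun x => .cons (toTree x.1) (toTree x.2)⟩

/-- The tree of a list. -/
def listTree : List α → BinTree
  | [] => .nil
  | a :: l => .cons (toTree a) (listTree l)

instance : TreeCode (List α) := ⟨listTree⟩

/-- The tree of a natural number in unary. -/
def natTree : ℕ → BinTree
  | 0 => .nil
  | n + 1 => .cons .nil (natTree n)

instance : TreeCode ℕ := ⟨natTree⟩

theorem code_false : code false = [false] := rfl
theorem code_true : code true = [true, false, false] := rfl
theorem code_nil : code ([] : List α) = [false] := rfl
theorem code_cons (a : α) (l : List α) : code (a :: l) = true :: (code a ++ code l) := rfl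
theorem code_pair (a : α) (b : β) : code (a, b) = true :: (code a ++ code b) := rfl
theorem code_succ (n : ℕ) : code (n + 1) = true :: false :: code n := rfl

@[simp] theorem size_nil : size ([] : List α) = 1 := rfl
@[simp] theorem size_cons (a : α) (l : List α) : size (a :: l) = size a + size l + 1 := by
  simp [size, code_cons]
@[simp] theorem size_pair (a : α) (b : β) : size (a, b) = size a + size b + 1 := by
  simp [size, code_pair]
@[simp] theorem size_nat (n : ℕ) : size n = 2 * n + 1 := by
  induction n with
  | zero => rfl
  | succ n ih => simp only [size, code_succ, List.length_cons] at ih ⊢; omega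

theorem size_bool_le (b : Bool) : size b ≤ 3 := by cases b <;> decide

theorem length_le_size (l : List α) : l.length ≤ size l := by
  induction l with
  | nil => simp
  | cons a l ih => simp; omega

theorem size_le_of_mem {a : α} {l : List α} (h : a ∈ l) : size a ≤ size l := by
  induction h with
  | head => simp; omega
  | tail _ _ ih => simp; omega

theorem size_list_le {l : List α} {B : ℕ} (h : ∀ a ∈ l, size a ≤ B) :
    size l ≤ l.length * (B + 1) + 1 := by
  induction l with
  | nil => simp
  | cons a l ih =>
    have h₁ := h a (by simp)
    have h₂ := ih fun b hb => h b (by simp [hb])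
    simp only [size_cons, List.length_cons, add_mul, one_mul]
    omega

theorem size_suffix_le {l l' : List α} (h : l' <:+ l) : size l' ≤ size l := by
  obtain ⟨p, rfl⟩ := h
  induction p with
  | nil => simp
  | cons a p ih => simp; omega

end TreeCode

open TreeCode

/-! ### Copying, deleting and exchanging codes on the working stack. -/

namespace Prog

open Function

/-- `Runs p S S' T`: the program `p` turns `S` into `S'` in at most `T` steps. -/
def Runs (p : Prog) (S S' : Tapes) (T : ℕ) : Prop := ∃ t ≤ T, Exec p S S' t

section tapes

variable (i o : List Computability.Γ') (b m a₁ a₂ d : List Bool)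

@[simp] theorem update_inp (x : List Computability.Γ') :
    update (tapes i o b m a₁ a₂ d) .inp x = tapes x o b m a₁ a₂ d := by
  funext k; cases k <;> rfl
@[simp] theorem update_outSym (x : List Computability.Γ') :
    update (tapes i o b m a₁ a₂ d) .outSym x = tapes i x b m a₁ a₂ d := by
  funext k; cases k <;> rfl
@[simp] theorem update_outBool (x : List Bool) :
    update (tapes i o b m a₁ a₂ d) .outBool x = tapes i o x m a₁ a₂ d := by
  funext k; cases k <;> rfl
@[simp] theorem update_main (x : List Bool) :
    update (tapes i o b m a₁ a₂ d) .main x = tapes i o b x a₁ a₂ d := by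
  funext k; cases k <;> rfl
@[simp] theorem update_aux₁ (x : List Bool) :
    update (tapes i o b m a₁ a₂ d) .aux₁ x = tapes i o b m x a₂ d := by
  funext k; cases k <;> rfl
@[simp] theorem update_aux₂ (x : List Bool) :
    update (tapes i o b m a₁ a₂ d) .aux₂ x = tapes i o b m a₁ x d := by
  funext k; cases k <;> rfl
@[simp] theorem update_depth (x : List Bool) :
    update (tapes i o b m a₁ a₂ d) .depth x = tapes i o b m a₁ a₂ x := by
  funext k; cases k <;> rfl

end tapes

theorem Runs.mono {p S S' T T'} (h : Runs p S S' T) (hT : T ≤ T') : Runs p S S' T' :=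
  let ⟨t, ht, he⟩ := h
  ⟨t, ht.trans hT, he⟩

theorem Runs.of_eq {p S S' S'' T T'} (h : Runs p S S' T) (hS : S' = S'') (hT : T ≤ T') :
    Runs p S S'' T' := hS ▸ h.mono hT

theorem runs_skip (S : Tapes) : Runs skip S S 1 := ⟨1, le_rfl, .skip S⟩

theorem runs_push {k : Tape} {a : k.Sym} {S S' : Tapes} (h : update S k (a :: S k) = S') :
    Runs (push k a) S S' 1 := ⟨1, le_rfl, h ▸ .push k a S⟩

theorem Runs.seq {p q S S' S'' T T'} (h : Runs p S S' T) (h' : Runs q S' S'' T') :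
    Runs (.seq p q) S S'' (T + T') :=
  let ⟨_, ht, he⟩ := h
  let ⟨_, ht', he'⟩ := h'
  ⟨_, add_le_add ht ht', he.seq he'⟩

theorem runs_popCase {k : Tape} {f : Option k.Sym → Prog} {S S₁ S' : Tapes} {T : ℕ}
    {o : Option k.Sym} (ho : (S k).head? = o) (hS : update S k (S k).tail = S₁)
    (h : Runs (f o) S₁ S' T) : Runs (popCase k f) S S' (T + 1) := by
  subst ho hS
  obtain ⟨t, ht, he⟩ := h
  exact ⟨t + 1, by omega, he.popCase⟩

theorem runs_loop_exit {k : Tape} {c : Option k.Sym → Bool} {f : Option k.Sym → Prog}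
    {S S' : Tapes} {o : Option k.Sym} (ho : (S k).head? = o) (hc : c o = false)
    (hS : update S k (S k).tail = S') : Runs (loop k c f) S S' 1 := by
  subst ho hS
  exact ⟨1, le_rfl, .loop_exit hc⟩

theorem runs_loop_step {k : Tape} {c : Option k.Sym → Bool} {f : Option k.Sym → Prog}
    {S S₁ S' S'' : Tapes} {T T' : ℕ} {o : Option k.Sym} (ho : (S k).head? = o)
    (hc : c o = true) (hS : update S k (S k).tail = S₁) (h : Runs (f o) S₁ S' T)
    (h' : Runs (loop k c f) S' S'' T') : Runs (loop k c f) S S'' (T + T' + 1) := by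
  subst ho hS
  obtain ⟨t, ht, he⟩ := h
  obtain ⟨t', ht', he'⟩ := h'
  exact ⟨t + t' + 1, by omega, .loop_step hc he he'⟩

/-- The stacks with empty input and output. -/
abbrev work (m a₁ a₂ d : List Bool) : Tapes := tapes [] [] [] m a₁ a₂ d

/-- The stacks that are empty except for the working stack. -/
abbrev only (m : List Bool) : Tapes := work m [] [] []

/-- Push a copy of `x` to those of the first two auxiliary stacks that are selected. -/
def emit (u v x : Bool) : Prog :=
  seq (bif u then push .aux₁ x else skip) (bif v then push .aux₂ x else skip)

theorem runs_emit (u v x : Bool) (m a₁ a₂ d : List Bool) :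
    Runs (emit u v x) (work m a₁ a₂ d)
      (work m (bif u then x :: a₁ else a₁) (bif v then x :: a₂ else a₂) d) 2 := by
  refine Runs.seq (T := 1) (T' := 1)
    (S' := work m (bif u then x :: a₁ else a₁) a₂ d) ?_ ?_
  · cases u
    · exact runs_skip _
    · exact runs_push (update_aux₁ ..)
  · cases v
    · exact runs_skip _
    · exact runs_push (update_aux₂ ..)

/-- The loop of `scan`. -/
def scanLoop (u v : Bool) : Prog :=
  loop .depth Option.isSome fun _ => popCase .main fun o =>
    match o with
    -- Never reached when the working stack starts with a complete code.
    | none => skip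
    | some true => seq (emit u v true) (seq (push .depth true) (push .depth true))
    | some false => emit u v false

/-- Remove one code from the working stack, and put its reversal on the selected stacks. -/
def scan (u v : Bool) : Prog := seq (push .depth true) (scanLoop u v)

/-- The height of `depth` is the number of subtrees still to be read: an inner node replaces one by
two, a leaf removes one. The continuation form, with an arbitrary rest of the run, lets the
induction chain the two subtrees. An inner node costs 6 steps, a leaf fewer. -/
theorem runs_scanLoop (u v : Bool) (x : BinTree) :
    ∀ {m a₁ a₂ d : List Bool} {S : Tapes} {T : ℕ},
      Runs (scanLoop u v) (work m (bif u then x.code.reverse ++ a₁ else a₁)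
        (bif v then x.code.reverse ++ a₂ else a₂) d) S T →
      Runs (scanLoop u v) (work (x.code ++ m) a₁ a₂ (true :: d)) S (T + 6 * x.code.length) := by
  induction x with
  | nil =>
    intro m a₁ a₂ d S T h
    have h' := runs_loop_step (k := .depth) (c := Option.isSome)
      (S := work (BinTree.nil.code ++ m) a₁ a₂ (true :: d)) (o := some true) rfl rfl
      (update_depth ..) (runs_popCase (k := .main) (o := some false) rfl (update_main ..)
        (runs_emit u v false _ _ _ _)) h
    exact Runs.mono h' (by simp [BinTree.code]; omega)
  | cons l r ihl ihr =>
    intro m a₁ a₂ d S T h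
    have h₁ := @ihr m (bif u then l.code.reverse ++ true :: a₁ else a₁)
      (bif v then l.code.reverse ++ true :: a₂ else a₂) d S T
      (by convert h using 2 <;> [cases u; cases v] <;> simp [BinTree.code])
    have h₂ := @ihl (r.code ++ m) (bif u then true :: a₁ else a₁) (bif v then true :: a₂ else a₂)
      (true :: d) S _ (by convert h₁ using 2 <;> [cases u; cases v] <;> rfl)
    have h₀ : work ((BinTree.cons l r).code ++ m) a₁ a₂ (true :: d) =
        work (true :: (l.code ++ (r.code ++ m))) a₁ a₂ (true :: d) := by simp [BinTree.code]
    have h₃ : Runs (seq (emit u v true) (seq (push .depth true) (push .depth true)))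
        (work (l.code ++ (r.code ++ m)) a₁ a₂ d)
        (work (l.code ++ (r.code ++ m)) (bif u then true :: a₁ else a₁)
          (bif v then true :: a₂ else a₂) (true :: true :: d)) _ :=
      (runs_emit u v true _ _ _ _).seq ((runs_push (update_depth ..)).seq
        (runs_push (update_depth ..)))
    rw [h₀]
    have h' := runs_loop_step (k := .depth) (c := Option.isSome)
      (S := work (true :: (l.code ++ (r.code ++ m))) a₁ a₂ (true :: d)) (o := some true) rfl rfl
      (update_depth ..) (runs_popCase (k := .main) (o := some true) rfl (update_main ..) h₃) h₂
    exact Runs.mono h' (by simp [BinTree.code]; omega)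

theorem runs_scan (u v : Bool) (x : BinTree) (m a₁ a₂ : List Bool) :
    Runs (scan u v) (work (x.code ++ m) a₁ a₂ []) (work m (bif u then x.code.reverse ++ a₁ else a₁)
        (bif v then x.code.reverse ++ a₂ else a₂) []) (6 * x.code.length + 2) := by
  have h := runs_scanLoop u v x (m := m) (a₁ := a₁) (a₂ := a₂) (d := [])
    (runs_loop_exit (k := .depth) (o := none) rfl rfl (update_depth ..))
  exact ((runs_push (update_depth ..)).seq h).mono (by omega)

/-- Move the first auxiliary stack to the working stack. -/
def pour₁ : Prog := loop .aux₁ Option.isSome fun o => push .main (o.getD true)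

/-- Move the second auxiliary stack to the working stack. -/
def pour₂ : Prog := loop .aux₂ Option.isSome fun o => push .main (o.getD true)

theorem runs_pour₁ (a₁ : List Bool) : ∀ m a₂ d : List Bool,
    Runs pour₁ (work m a₁ a₂ d) (work (a₁.reverse ++ m) [] a₂ d) (2 * a₁.length + 1) := by
  induction a₁ with
  | nil => exact fun m a₂ d => runs_loop_exit (o := none) rfl rfl (update_aux₁ ..)
  | cons x a₁ ih =>
    intro m a₂ d
    have h := runs_loop_step (k := .aux₁) (c := Option.isSome) (S := work m (x :: a₁) a₂ d)
      (o := some x) rfl rfl (update_aux₁ ..) (runs_push (update_main ..)) (ih (x :: m) a₂ d)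
    exact h.of_eq (by simp) (by simp; omega)

theorem runs_pour₂ (a₂ : List Bool) : ∀ m a₁ d : List Bool,
    Runs pour₂ (work m a₁ a₂ d) (work (a₂.reverse ++ m) a₁ [] d) (2 * a₂.length + 1) := by
  induction a₂ with
  | nil => exact fun m a₁ d => runs_loop_exit (o := none) rfl rfl (update_aux₂ ..)
  | cons x a₂ ih =>
    intro m a₁ d
    have h := runs_loop_step (k := .aux₂) (c := Option.isSome) (S := work m a₁ (x :: a₂) d)
      (o := some x) rfl rfl (update_aux₂ ..) (runs_push (update_main ..)) (ih (x :: m) a₁ d)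
    exact h.of_eq (by simp) (by simp; omega)

/-- Duplicate the top code of the working stack. -/
def dup : Prog := seq (scan true true) (seq pour₁ pour₂)

/-- Remove the top code of the working stack. -/
def drop : Prog := scan false false

/-- Exchange the two top codes of the working stack. -/
def swap : Prog := seq (scan true false) (seq (scan false true) (seq pour₁ pour₂))

variable {α β : Type} [TreeCode α] [TreeCode β]

theorem runs_dup (a : α) (m : List Bool) :
    Runs dup (only (code a ++ m)) (only (code a ++ (code a ++ m))) (20 * size a) := by
  have h := (runs_scan true true (toTree a) m [] []).seq
    ((runs_pour₁ _ _ _ _).seq (runs_pour₂ _ _ _ _))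
  -- Positivity absorbs the additive constants of the running times into the factor 20.
  have : 0 < size a := by unfold size code; cases toTree a <;> simp [BinTree.code]
  exact h.of_eq (by simp [code]) (by simp [size, code] at this ⊢; omega)

theorem runs_drop (a : α) (m : List Bool) :
    Runs drop (only (code a ++ m)) (only m) (20 * size a) := by
  have : 0 < size a := by unfold size code; cases toTree a <;> simp [BinTree.code]
  exact (runs_scan false false (toTree a) m [] []).mono (by unfold size code at *; omega)

/-- Each code lies reversed on its own auxiliary stack, and pouring restores its direction. The code
poured last ends on top. -/
theorem runs_swap (a : α) (b : β) (m : List Bool) :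
    Runs swap (only (code a ++ (code b ++ m))) (only (code b ++ (code a ++ m)))
      (20 * (size a + size b)) := by
  have h := (runs_scan true false (toTree a) (code b ++ m) [] []).seq
    ((runs_scan false true (toTree b) m _ _).seq
    ((runs_pour₁ _ _ _ _).seq (runs_pour₂ _ _ _ _)))
  have : 0 < size a := by unfold size code; cases toTree a <;> simp [BinTree.code]
  exact h.of_eq (by simp [code]) (by simp [size, code] at this ⊢; omega)

/-- Push a word to the working stack. -/
def pushWord : List Bool → Prog
  | [] => skip
  | x :: l => seq (pushWord l) (push .main x)

theorem runs_pushWord (l : List Bool) (i o b m a₁ a₂ d) :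
    Runs (pushWord l) (tapes i o b m a₁ a₂ d) (tapes i o b (l ++ m) a₁ a₂ d) (l.length + 1) := by
  induction l with
  | nil => exact runs_skip _
  | cons x l ih => exact ih.seq (runs_push (update_main ..))

theorem runs_pushMain (x : Bool) (m : List Bool) :
    Runs (push .main x) (only m) (only (x :: m)) 1 := runs_push (update_main ..)

theorem runs_popMain {x : Bool} {m m' : List Bool} {f : Option Bool → Prog} {S' : Tapes} {T : ℕ}
    (hm : m' = x :: m) (h : Runs (f (some x)) (only m) S' T) :
    Runs (popCase .main f) (only m') S' (T + 1) := by
  subst hm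
  exact runs_popCase (o := some x) rfl (update_main ..) h

end Prog

/-! ### Polynomial bounds and the closure properties of polynomial time. -/

/-- `g` is bounded by a polynomial in the size of its argument. -/
def PolyBounded {α : Type} [TreeCode α] (g : α → ℕ) : Prop :=
  ∃ P : Polynomial ℕ, ∀ a, g a ≤ P.eval (size a)

/-- `f` is computed by a program in polynomial time. -/
@[fun_prop]
def PolyTime {α β : Type} [TreeCode α] [TreeCode β] (f : α → β) : Prop :=
  ∃ (p : Prog) (P : Polynomial ℕ), ∀ a, size (f a) ≤ P.eval (size a) ∧
    ∀ m, p.Runs (Prog.only (code a ++ m)) (Prog.only (code (f a) ++ m)) (P.eval (size a))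

/-- Coefficients in `ℕ` make time bounds monotone, so size estimates can be substituted into them.
-/
theorem Polynomial.eval_le_eval_nat (P : Polynomial ℕ) {m n : ℕ} (h : m ≤ n) :
    P.eval m ≤ P.eval n := by
  simp only [Polynomial.eval_eq_sum, Polynomial.sum]
  gcongr

variable {α β γ δ : Type} [TreeCode α] [TreeCode β] [TreeCode γ] [TreeCode δ]

namespace PolyBounded

variable {g h : α → ℕ}

theorem mono (hg : PolyBounded g) (hh : ∀ a, h a ≤ g a) : PolyBounded h :=
  let ⟨P, hP⟩ := hg
  ⟨P, fun a => (hh a).trans (hP a)⟩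

theorem const (n : ℕ) : PolyBounded fun _ : α => n :=
  ⟨Polynomial.C n, fun a => by simp⟩

theorem size : PolyBounded (size : α → ℕ) :=
  ⟨Polynomial.X, fun a => by simp⟩

theorem add (hg : PolyBounded g) (hh : PolyBounded h) : PolyBounded fun a => g a + h a := by
  obtain ⟨P, hP⟩ := hg
  obtain ⟨Q, hQ⟩ := hh
  exact ⟨P + Q, fun a => by simpa using add_le_add (hP a) (hQ a)⟩

theorem mul (hg : PolyBounded g) (hh : PolyBounded h) : PolyBounded fun a => g a * h a := by
  obtain ⟨P, hP⟩ := hg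
  obtain ⟨Q, hQ⟩ := hh
  exact ⟨P * Q, fun a => by simpa using Nat.mul_le_mul (hP a) (hQ a)⟩

theorem eval (P : Polynomial ℕ) (hg : PolyBounded g) : PolyBounded fun a => P.eval (g a) := by
  obtain ⟨Q, hQ⟩ := hg
  exact ⟨P.comp Q, fun a => by
    simpa [Polynomial.eval_comp] using P.eval_le_eval_nat (hQ a)⟩

theorem comp {f : γ → α} (hg : PolyBounded g) (hf : PolyBounded fun c => TreeCode.size (f c)) :
    PolyBounded fun c => g (f c) := by
  obtain ⟨P, hP⟩ := hg
  exact (eval P hf).mono fun c => hP (f c)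

end PolyBounded

namespace PolyTime

open Prog

theorem size_bounded {f : α → β} (hf : PolyTime f) : PolyBounded fun a => size (f a) :=
  let ⟨_, P, h⟩ := hf
  ⟨P, fun a => (h a).1⟩

theorem of_runs {f : α → β} (p : Prog) {T : α → ℕ} (hs : PolyBounded fun a => size (f a))
    (hT : PolyBounded T)
    (h : ∀ a m, p.Runs (only (code a ++ m)) (only (code (f a) ++ m)) (T a)) : PolyTime f := by
  obtain ⟨P, hP⟩ := hs
  obtain ⟨Q, hQ⟩ := hT
  refine ⟨p, P + Q, fun a => ⟨?_, fun m => (h a m).mono ?_⟩⟩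
  · simpa using (hP a).trans (Nat.le_add_right ..)
  · simpa using (hQ a).trans (Nat.le_add_left ..)

theorem exists_runs {f : α → β} (hf : PolyTime f) : ∃ (p : Prog) (T : α → ℕ), PolyBounded T ∧
    ∀ a m, p.Runs (only (code a ++ m)) (only (code (f a) ++ m)) (T a) :=
  let ⟨p, P, h⟩ := hf
  ⟨p, fun a => P.eval (size a), ⟨P, fun _ => le_rfl⟩, fun a => (h a).2⟩

theorem of_code_eq {f : α → β} (h : ∀ a, code (f a) = code a) : PolyTime f :=
  of_runs skip (PolyBounded.size.mono fun a => by simp [size, h]) (PolyBounded.const 1)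
    fun a m => by rw [h]; exact runs_skip _

@[fun_prop]
theorem id : PolyTime fun a : α => a := of_code_eq fun _ => rfl

@[fun_prop]
theorem const (b : β) : PolyTime fun _ : α => b :=
  of_runs (.seq drop (pushWord (code b))) (PolyBounded.const _)
    (((PolyBounded.const 20).mul .size).add (.const _))
    fun a m => (runs_drop a m).seq (runs_pushWord (code b) [] [] [] m [] [] [])

@[fun_prop]
theorem comp {g : β → γ} {f : α → β} (hg : PolyTime g) (hf : PolyTime f) :
    PolyTime fun a => g (f a) := by
  obtain ⟨p, T, hT, hp⟩ := hf.exists_runs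
  obtain ⟨q, U, hU, hq⟩ := hg.exists_runs
  exact of_runs (.seq p q) (hg.size_bounded.comp hf.size_bounded)
    (hT.add (hU.comp hf.size_bounded)) fun a m => (hp a m).seq (hq (f a) m)

@[fun_prop]
theorem prodMk {f : α → β} {g : α → γ} (hf : PolyTime f) (hg : PolyTime g) :
    PolyTime fun a => (f a, g a) := by
  obtain ⟨p, T, hT, hp⟩ := hf.exists_runs
  obtain ⟨q, U, hU, hq⟩ := hg.exists_runs
  refine of_runs (.seq dup (.seq p (.seq swap (.seq q (.seq swap (.push .main true))))))
    (T := fun a => 20 * size a + (T a + (20 * (size (f a) + size a) + (U a +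
      (20 * (size (g a) + size (f a)) + 1)))))
    (((hf.size_bounded.add hg.size_bounded).add (.const 1)).mono fun a => by simp)
    (((PolyBounded.const 20).mul .size).add (hT.add (((PolyBounded.const 20).mul
      (hf.size_bounded.add .size)).add (hU.add (((PolyBounded.const 20).mul
      (hg.size_bounded.add hf.size_bounded)).add (.const 1)))))) fun a m => ?_
  exact (runs_dup a m).seq ((hp a _).seq ((runs_swap (f a) a m).seq ((hq a _).seq
    ((runs_swap (g a) (f a) m).seq ((runs_pushMain _ _).of_eq
      (by simp [code_pair]) le_rfl)))))

theorem fst' : PolyTime (Prod.fst : α × β → α) :=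
  of_runs (.popCase .main fun _ => .seq swap drop)
    (T := fun x => 20 * (size x.1 + size x.2) + 20 * size x.2 + 1)
    (PolyBounded.size.mono fun x => by obtain ⟨a, b⟩ := x; simp; omega)
    ((((PolyBounded.const 40).mul .size).add (.const 1)).mono
      fun x => by obtain ⟨a, b⟩ := x; simp; omega)
    fun ⟨a, b⟩ m => runs_popMain (by simp [code_pair]; rfl)
      ((runs_swap a b m).seq (runs_drop b _))

theorem snd' : PolyTime (Prod.snd : α × β → β) :=
  of_runs (.popCase .main fun _ => drop) (T := fun x => 20 * size x.1 + 1)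
    (PolyBounded.size.mono fun x => by obtain ⟨a, b⟩ := x; simp; omega)
    ((((PolyBounded.const 40).mul .size).add (.const 1)).mono
      fun x => by obtain ⟨a, b⟩ := x; simp; omega)
    fun ⟨a, b⟩ m => runs_popMain (by simp [code_pair]; rfl) (runs_drop a _)

@[fun_prop]
theorem fst {f : α → β × γ} (hf : PolyTime f) : PolyTime fun a => (f a).1 := fst'.comp hf

@[fun_prop]
theorem snd {f : α → β × γ} (hf : PolyTime f) : PolyTime fun a => (f a).2 := snd'.comp hf

@[fun_prop]
theorem cond {c : α → Bool} {f g : α → β} (hc : PolyTime c) (hf : PolyTime f) (hg : PolyTime g) :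
    PolyTime fun a => bif c a then f a else g a := by
  obtain ⟨r, V, hV, hr⟩ := hc.exists_runs
  obtain ⟨p, T, hT, hp⟩ := hf.exists_runs
  obtain ⟨q, U, hU, hq⟩ := hg.exists_runs
  -- The code of `true` has three symbols, hence two further pops in the positive branch.
  refine of_runs (.seq dup (.seq r (.popCase .main fun (o : Option Bool) => bif o == some true then
      .popCase .main fun _ => .popCase .main fun _ => p else q)))
    (T := fun a => 20 * size a + (V a + (T a + U a + 3)))
    ((hf.size_bounded.add hg.size_bounded).mono fun a => by cases c a <;> simp)
    (((PolyBounded.const 20).mul .size).add (hV.add ((hT.add hU).add (.const 3)))) fun a m => ?_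
  refine (runs_dup a m).seq ((hr a _).seq ?_)
  cases hca : c a
  · exact (runs_popMain (x := false) (by rw [code_false]; rfl) (hq a m)).mono (by omega)
  · exact (runs_popMain (x := true) (by rw [code_true]; rfl) (runs_popMain rfl
      (runs_popMain rfl (hp a m)))).mono (by omega)

/-- A nonempty list and the pair of its head and tail have the same code. It is enough to look at
the first symbol, put it back, and pair the result with the argument. -/
theorem casesOn_list {l : α → List β} {f : α → γ} {g : α × (β × List β) → γ} (hl : PolyTime l)
    (hf : PolyTime f) (hg : PolyTime g) :
    PolyTime fun a => match l a with
      | [] => f a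
      | b :: t => g (a, (b, t)) := by
  obtain ⟨r, V, hV, hr⟩ := hl.exists_runs
  obtain ⟨p, T, hT, hp⟩ := hf.exists_runs
  obtain ⟨q, U, ⟨Q, hQ⟩, hq⟩ := hg.exists_runs
  obtain ⟨Q', hQ'⟩ := hg.size_bounded
  have hs : PolyBounded fun a => size a + size (l a) + 1 :=
    (PolyBounded.size.add hl.size_bounded).add (.const 1)
  refine of_runs (.seq dup (.seq r (.popCase .main fun (o : Option Bool) => bif o == some true then
      .seq (.push .main true) (.seq swap (.seq (.push .main true) q)) else p)))
    (T := fun a => 20 * size a + (V a + (T a + (20 * (size (l a) + size a)) +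
      Q.eval (size a + size (l a) + 1) + 3)))
    ((hf.size_bounded.add (hs.eval Q')).mono fun a => ?_)
    (((PolyBounded.const 20).mul .size).add (hV.add (((hT.add (((PolyBounded.const 20).mul
      (hl.size_bounded.add .size)))).add (hs.eval Q)).add (.const 3)))) fun a m => ?_
  · split
    · omega
    · next b t h =>
      refine le_trans ((hQ' _).trans (Q'.eval_le_eval_nat ?_)) (Nat.le_add_left ..)
      simp [h]
  · refine (runs_dup a m).seq ((hr a _).seq ?_)
    split
    · next h =>
      exact (runs_popMain (x := false) (by rw [h, code_nil]; rfl) (hp a m)).mono (by omega)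
    · next b t h =>
      have h₁ := runs_swap (b, t) a m
      have h₂ := (hq (a, (b, t)) m).mono ((hQ _).trans (Q.eval_le_eval_nat (n :=
        size a + size (l a) + 1) (by simp [h])))
      refine (runs_popMain (x := true) (m := code b ++ (code t ++ (code a ++ m)))
        (by rw [h, code_cons]; simp) ((((runs_pushMain true _).of_eq (by
        rw [code_pair]; simp) le_rfl).seq (h₁.seq (((runs_pushMain true _).of_eq (by
        rw [code_pair a]; simp) le_rfl).seq h₂))))).mono ?_
      have : size (b, t) = size (l a) := by rw [h]; simp
      omega

/-- The list serves as a unary counter; its members are dropped unread. The uniform bound `B` on all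
iterates is indispensable, because iterating a polynomial-time function can make sizes explode. -/
theorem iterate_runs {f : β → β} {p : Prog} {P : Polynomial ℕ}
    (hp : ∀ b m, p.Runs (only (code b ++ m)) (only (code (f b) ++ m)) (P.eval (size b)))
    {B : ℕ} (l : List δ) : ∀ b m, (∀ k ≤ l.length, size (f^[k] b) ≤ B) →
      (Prog.loop .main (fun (o : Option Bool) => o == some true)
        fun _ => .seq drop (.seq swap (.seq p swap))).Runs
        (only (code l ++ (code b ++ m))) (only (code (f^[l.length] b) ++ m))
        (l.length * (60 * (size l + B) + P.eval B + 1) + 1) := by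
  induction l with
  | nil =>
    exact fun b m _ => (runs_loop_exit (k := .main) (o := some false) rfl rfl
      (update_main ..)).mono (by simp)
  | cons d l ih =>
    intro b m hB
    have h₀ : size b ≤ B := hB 0 (Nat.zero_le _)
    have h₁ : size (f b) ≤ B := hB 1 (by simp)
    have h := ih (f b) m fun k hk => by
      simpa using hB (k + 1) (by simpa using hk)
    have hs := (runs_drop d _).seq ((runs_swap l b m).seq ((hp b _).seq
      (runs_swap (f b) l m)))
    have e : only (code (d :: l) ++ (code b ++ m)) =
        only (true :: (code d ++ (code l ++ (code b ++ m)))) := by simp [code_cons]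
    rw [e]
    refine (runs_loop_step (k := .main) (o := some true) rfl rfl (update_main ..) hs h).mono ?_
    have h₂ := P.eval_le_eval_nat h₀
    have h₃ : l.length * (60 * (size l + B) + P.eval B + 1) ≤
        l.length * (60 * (size (d :: l) + B) + P.eval B + 1) := by
      gcongr; simp; omega
    simp only [List.length_cons, add_mul l.length 1, one_mul]
    simp only [size_cons] at *
    omega

theorem iterate {l : α → List δ} {i : α → β} {f : β → β} {B : α → ℕ} (hl : PolyTime l)
    (hi : PolyTime i) (hf : PolyTime f) (hB : PolyBounded B)
    (h : ∀ a, ∀ k ≤ (l a).length, size (f^[k] (i a)) ≤ B a) :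
    PolyTime fun a => f^[(l a).length] (i a) := by
  obtain ⟨q, T, hT, hq⟩ := (hl.prodMk hi).exists_runs
  obtain ⟨p, P, hp⟩ := hf
  refine of_runs (.seq q (.popCase .main fun _ => _)) (hB.mono fun a => h a _ le_rfl)
    (T := fun a => T a + (size (l a) * (60 * (size (l a) + B a) + P.eval (B a) + 1) + 1 + 1))
    (hT.add (((hl.size_bounded.mul ((((PolyBounded.const 60).mul (hl.size_bounded.add hB)).add
      (hB.eval P)).add (.const 1))).add (.const 1)).add (.const 1)))
    fun a m => (hq a m).seq (runs_popMain (by simp [code_pair]; rfl)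
      ((iterate_runs (fun b m => (hp b).2 m) (l a) (i a) m (h a)).mono ?_))
  have := length_le_size (l a)
  gcongr

end PolyTime

namespace PolyTime

theorem congr {f g : α → β} (hf : PolyTime f) (h : ∀ a, f a = g a) : PolyTime g :=
  funext h ▸ hf

/-! ### Folds -/

@[fun_prop]
theorem list_cons {f : α → β} {l : α → List β} (hf : PolyTime f) (hl : PolyTime l) :
    PolyTime fun a => f a :: l a :=
  comp (g := fun x : β × List β => x.1 :: x.2) (of_code_eq fun _ => rfl) (hf.prodMk hl)

/-- The fold is an iteration on triples of parameter, accumulator and remaining list. The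
accumulators that occur are the folds of prefixes, so only these need a bound. -/
theorem list_foldl {l : γ → List α} {i : γ → β} {s : γ → β → α → β} {B : γ → ℕ}
    (hl : PolyTime l) (hi : PolyTime i) (hs : PolyTime fun x : γ × β × α => s x.1 x.2.1 x.2.2)
    (hB : PolyBounded B) (h : ∀ c, ∀ l', l' <+: l c → size (l'.foldl (s c) (i c)) ≤ B c) :
    PolyTime fun c => (l c).foldl (s c) (i c) := by
  let F : γ × β × List α → γ × β × List α := fun x =>
    match x.2.2 with
    | [] => x
    | a :: t => (x.1, s x.1 x.2.1 a, t)
  have hF : PolyTime F := by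
    refine casesOn_list (l := fun x : γ × β × List α => x.2.2) (f := fun x => x)
      (g := fun y => (y.1.1, s y.1.1 y.1.2.1 y.2.1, y.2.2)) (by fun_prop) (by fun_prop) ?_
    have : PolyTime fun y : (γ × β × List α) × α × List α => s y.1.1 y.1.2.1 y.2.1 :=
      hs.comp (f := fun y : (γ × β × List α) × α × List α => (y.1.1, y.1.2.1, y.2.1))
        (by fun_prop)
    fun_prop
  have hit : ∀ (c : γ) (k : ℕ) (b : β) (m : List α), k ≤ m.length →
      F^[k] (c, b, m) = (c, (m.take k).foldl (s c) b, m.drop k) := by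
    intro c k
    induction k with
    | zero => simp
    | succ k ih =>
      intro b m hk
      cases m with
      | nil => simp at hk
      | cons a m => simpa [F] using ih (s c b a) m (by simpa using hk)
  have key : PolyTime fun c => F^[(l c).length] (c, i c, l c) := by
    refine iterate (B := fun c => size c + (B c + size (l c) + 1) + 1) hl (by fun_prop) hF
      ((PolyBounded.size.add ((hB.add hl.size_bounded).add (.const 1))).add (.const 1))
      fun c k hk => ?_
    rw [hit c k _ _ hk]
    have h₁ := h c _ (List.take_prefix k (l c))
    have h₂ := size_suffix_le (List.drop_suffix k (l c))
    simp only [size_pair]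
    omega
  have := key.snd.fst
  refine this.congr fun c => ?_
  rw [hit c _ _ _ le_rfl]
  simp

/-- If each step adds at most `B c` to a measure that controls the size, the growth over the whole
fold is at most the length times `B c`. For binary numbers the measure is the number of digits. -/
theorem list_foldl_of_measure_le {l : γ → List α} {i : γ → β} {s : γ → β → α → β} {B : γ → ℕ}
    (μ : β → ℕ) (P : Polynomial ℕ) (hμ : ∀ b, size b ≤ P.eval (μ b))
    (hl : PolyTime l) (hi : PolyTime i) (hs : PolyTime fun x : γ × β × α => s x.1 x.2.1 x.2.2)
    (hμi : PolyBounded fun c => μ (i c)) (hB : PolyBounded B)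
    (h : ∀ c b, ∀ a ∈ l c, μ (s c b a) ≤ μ b + B c) :
    PolyTime fun c => (l c).foldl (s c) (i c) := by
  refine list_foldl (B := fun c => P.eval (μ (i c) + size (l c) * B c)) hl hi hs
    ((hμi.add (hl.size_bounded.mul hB)).eval P) fun c l' hl' => ?_
  have key : ∀ m : List α, (∀ a ∈ m, a ∈ l c) → ∀ b,
      μ (m.foldl (s c) b) ≤ μ b + m.length * B c := by
    intro m
    induction m with
    | nil => simp
    | cons a m ih =>
      intro hm b
      have h₁ := h c b a (hm a (by simp))
      have h₂ := ih (fun a' ha' => hm a' (by simp [ha'])) (s c b a)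
      simp only [List.foldl_cons, List.length_cons, add_mul, one_mul]
      omega
  refine (hμ _).trans (P.eval_le_eval_nat ((key l' (fun a ha => hl'.subset ha) (i c)).trans ?_))
  gcongr
  exact hl'.length_le.trans (length_le_size _)

theorem list_foldl_of_size_le {l : γ → List α} {i : γ → β} {s : γ → β → α → β} {B : γ → ℕ}
    (hl : PolyTime l) (hi : PolyTime i) (hs : PolyTime fun x : γ × β × α => s x.1 x.2.1 x.2.2)
    (hB : PolyBounded B) (h : ∀ c b, ∀ a ∈ l c, size (s c b a) ≤ size b + B c) :
    PolyTime fun c => (l c).foldl (s c) (i c) :=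
  list_foldl_of_measure_le size Polynomial.X (by simp) hl hi hs hi.size_bounded hB h

@[fun_prop]
theorem list_reverse {l : γ → List α} (hl : PolyTime l) : PolyTime fun c => (l c).reverse := by
  have : PolyTime fun c => (l c).foldl (fun b a => a :: b) [] :=
    list_foldl_of_size_le (B := fun c => size (l c) + 1) hl (const []) (by fun_prop)
      (hl.size_bounded.add (.const 1)) fun c b a ha => by
        have := size_le_of_mem ha
        simp only [size_cons]; omega
  simpa using this

theorem list_foldr_of_measure_le {l : γ → List α} {i : γ → β} {s : γ → α → β → β} {B : γ → ℕ}
    (μ : β → ℕ) (P : Polynomial ℕ) (hμ : ∀ b, size b ≤ P.eval (μ b))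
    (hl : PolyTime l) (hi : PolyTime i) (hs : PolyTime fun x : γ × α × β => s x.1 x.2.1 x.2.2)
    (hμi : PolyBounded fun c => μ (i c)) (hB : PolyBounded B)
    (h : ∀ c b, ∀ a ∈ l c, μ (s c a b) ≤ μ b + B c) :
    PolyTime fun c => (l c).foldr (s c) (i c) := by
  have := list_foldl_of_measure_le (s := fun c b a => s c a b) μ P hμ hl.list_reverse hi
    (hs.comp (f := fun x : γ × β × α => (x.1, x.2.2, x.2.1)) (by fun_prop)) hμi hB
    fun c b a ha => h c b a (by simpa using ha)
  simpa using this

theorem list_foldr_of_size_le {l : γ → List α} {i : γ → β} {s : γ → α → β → β} {B : γ → ℕ}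
    (hl : PolyTime l) (hi : PolyTime i) (hs : PolyTime fun x : γ × α × β => s x.1 x.2.1 x.2.2)
    (hB : PolyBounded B) (h : ∀ c b, ∀ a ∈ l c, size (s c a b) ≤ size b + B c) :
    PolyTime fun c => (l c).foldr (s c) (i c) :=
  list_foldr_of_measure_le size Polynomial.X (by simp) hl hi hs hi.size_bounded hB h

/-! ### Booleans -/

@[fun_prop]
theorem not {f : α → Bool} (hf : PolyTime f) : PolyTime fun a => !f a := by
  have := hf.cond (const false) (const true)
  refine this.congr fun a => ?_
  cases f a <;> rfl

@[fun_prop]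
theorem and {f g : α → Bool} (hf : PolyTime f) (hg : PolyTime g) :
    PolyTime fun a => f a && g a := by
  have := hf.cond hg (const false)
  refine this.congr fun a => ?_
  cases f a <;> rfl

@[fun_prop]
theorem or {f g : α → Bool} (hf : PolyTime f) (hg : PolyTime g) :
    PolyTime fun a => f a || g a := by
  have := hf.cond (const true) hg
  refine this.congr fun a => ?_
  cases f a <;> rfl

@[fun_prop]
theorem xor {f g : α → Bool} (hf : PolyTime f) (hg : PolyTime g) :
    PolyTime fun a => f a ^^ g a := by
  have := hf.cond hg.not hg
  refine this.congr fun a => ?_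
  cases f a <;> simp

/-! ### Lists -/

theorem size_bounded_of_mem {f : γ → α → β} {l : γ → List α} (hl : PolyTime l)
    (hf : PolyTime fun x : γ × α => f x.1 x.2) :
    ∃ B : γ → ℕ, PolyBounded B ∧ ∀ c, ∀ a ∈ l c, size (f c a) ≤ B c := by
  obtain ⟨P, hP⟩ := hf.size_bounded
  refine ⟨_, ((PolyBounded.size.add hl.size_bounded).add (.const 1)).eval P, fun c a ha => ?_⟩
  refine (hP (c, a)).trans (P.eval_le_eval_nat ?_)
  have := size_le_of_mem ha
  simp only [size_pair]; omega

@[fun_prop]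
theorem list_map {f : γ → α → β} {l : γ → List α} (hl : PolyTime l)
    (hf : PolyTime fun x : γ × α => f x.1 x.2) : PolyTime fun c => (l c).map (f c) := by
  obtain ⟨B, hB, h⟩ := size_bounded_of_mem hl hf
  have h' : PolyTime fun x : γ × α × List β => f x.1 x.2.1 :=
    hf.comp (f := fun x : γ × α × List β => (x.1, x.2.1)) (by fun_prop)
  have := list_foldr_of_size_le (s := fun c a b => f c a :: b) (i := fun _ => [])
    hl (const _) (by fun_prop) (hB.add (.const 1)) fun c b a ha => by
      have := h c a ha
      simp only [size_cons]; omega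
  refine this.congr fun c => ?_
  induction l c <;> simp [*]

@[fun_prop]
theorem list_filter {p : γ → α → Bool} {l : γ → List α} (hl : PolyTime l)
    (hp : PolyTime fun x : γ × α => p x.1 x.2) : PolyTime fun c => (l c).filter (p c) := by
  have h' : PolyTime fun x : γ × α × List α => p x.1 x.2.1 :=
    hp.comp (f := fun x : γ × α × List α => (x.1, x.2.1)) (by fun_prop)
  have := list_foldr_of_size_le (s := fun c a b => bif p c a then a :: b else b)
    (i := fun _ => []) (B := fun c => size (l c) + 1)
    hl (const _) (by fun_prop) (hl.size_bounded.add (.const 1)) fun c b a ha => by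
      have := size_le_of_mem ha
      cases p c a
      · simp
      · simp; omega
  refine this.congr fun c => ?_
  induction l c with
  | nil => rfl
  | cons a l ih => cases h : p c a <;> simp [h, ih]

@[fun_prop]
theorem list_takeWhile {p : γ → α → Bool} {l : γ → List α} (hl : PolyTime l)
    (hp : PolyTime fun x : γ × α => p x.1 x.2) : PolyTime fun c => (l c).takeWhile (p c) := by
  have h' : PolyTime fun x : γ × α × List α => p x.1 x.2.1 :=
    hp.comp (f := fun x : γ × α × List α => (x.1, x.2.1)) (by fun_prop)
  have := list_foldr_of_size_le (s := fun c a b => bif p c a then a :: b else [])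
    (i := fun _ => []) (B := fun c => size (l c) + 1)
    hl (const _) (by fun_prop) (hl.size_bounded.add (.const 1)) fun c b a ha => by
      have := size_le_of_mem ha
      cases p c a <;> (simp; omega)
  refine this.congr fun c => ?_
  induction l c with
  | nil => rfl
  | cons a l ih => cases h : p c a <;> simp [h, ih]

@[fun_prop]
theorem list_any {p : γ → α → Bool} {l : γ → List α} (hl : PolyTime l)
    (hp : PolyTime fun x : γ × α => p x.1 x.2) : PolyTime fun c => (l c).any (p c) := by
  have h' : PolyTime fun x : γ × α × Bool => p x.1 x.2.1 :=
    hp.comp (f := fun x : γ × α × Bool => (x.1, x.2.1)) (by fun_prop)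
  have := list_foldr_of_size_le (s := fun c a b => p c a || b)
    (i := fun _ => false) (B := fun c => 3)
    hl (const _) (by fun_prop) (.const 3) fun c b a ha =>
      (size_bool_le _).trans (Nat.le_add_left ..)
  refine this.congr fun c => ?_
  induction l c <;> simp [*]

@[fun_prop]
theorem list_append {l m : γ → List α} (hl : PolyTime l) (hm : PolyTime m) :
    PolyTime fun c => l c ++ m c := by
  have := list_foldr_of_size_le (s := fun _ a b => a :: b) (i := m)
    (B := fun c => size (l c) + 1)
    hl hm (by fun_prop) (hl.size_bounded.add (.const 1)) fun c b a ha => by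
      have := size_le_of_mem ha
      simp only [size_cons]; omega
  simpa using this

@[fun_prop]
theorem list_headD {l : γ → List α} {d : γ → α} (hl : PolyTime l) (hd : PolyTime d) :
    PolyTime fun c => (l c).headD (d c) := by
  have := casesOn_list (g := fun x : γ × α × List α => x.2.1) hl hd (by fun_prop)
  refine this.congr fun c => ?_
  cases l c <;> rfl

@[fun_prop]
theorem list_tail {l : γ → List α} (hl : PolyTime l) : PolyTime fun c => (l c).tail := by
  have := casesOn_list (g := fun x : γ × α × List α => x.2.2) hl (const []) (by fun_prop)
  refine this.congr fun c => ?_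
  cases l c <;> rfl

/-! ### Unary numbers -/

/-- A unary number is literally a list of units, so list operations provide unary arithmetic. -/
theorem code_replicate (n : ℕ) : code (List.replicate n ()) = code n := by
  induction n with
  | zero => rfl
  | succ n ih => rw [List.replicate_succ, code_cons, code_succ, ih]; rfl

@[fun_prop]
theorem list_length {l : γ → List α} (hl : PolyTime l) : PolyTime fun c => (l c).length := by
  have h : PolyTime fun c => (l c).map fun _ => () := list_map hl (const ())
  have h' : PolyTime fun l : List Unit => l.length := of_code_eq fun l => by
    rw [← code_replicate]
    congr 1
    exact (List.eq_replicate_of_mem fun _ _ => rfl).symm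
  exact (h'.comp h).congr fun c => by simp

@[fun_prop]
theorem list_replicate_unit {n : γ → ℕ} (hn : PolyTime n) :
    PolyTime fun c => List.replicate (n c) () :=
  comp (g := fun n : ℕ => List.replicate n ()) (of_code_eq code_replicate) hn

theorem nat_iterate {n : γ → ℕ} {i : γ → β} {f : γ → β → β} {B : γ → ℕ} (hn : PolyTime n)
    (hi : PolyTime i) (hf : PolyTime fun x : γ × β => f x.1 x.2) (hB : PolyBounded B)
    (h : ∀ c, ∀ k ≤ n c, size ((f c)^[k] (i c)) ≤ B c) :
    PolyTime fun c => (f c)^[n c] (i c) := by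
  have := list_foldl (s := fun c b (_ : Unit) => f c b) hn.list_replicate_unit hi
    (hf.comp (f := fun x : γ × β × Unit => (x.1, x.2.1)) (by fun_prop)) hB fun c l' hl' => by
      rw [List.foldl_const]
      exact h c _ (by simpa using hl'.length_le)
  simpa [List.foldl_const] using this

@[fun_prop]
theorem nat_succ {n : γ → ℕ} (hn : PolyTime n) : PolyTime fun c => n c + 1 := by
  have := (list_cons (const ()) hn.list_replicate_unit).list_length
  simpa using this

@[fun_prop]
theorem nat_add {m n : γ → ℕ} (hm : PolyTime m) (hn : PolyTime n) :
    PolyTime fun c => m c + n c := by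
  have := (hm.list_replicate_unit.list_append hn.list_replicate_unit).list_length
  simpa using this

@[fun_prop]
theorem list_drop {l : γ → List α} {n : γ → ℕ} (hl : PolyTime l) (hn : PolyTime n) :
    PolyTime fun c => (l c).drop (n c) := by
  have hit (m : List α) (k : ℕ) : List.tail^[k] m = m.drop k := by
    induction k generalizing m with
    | zero => rfl
    | succ k ih => rw [Function.iterate_succ_apply, ih]; simp
  have := nat_iterate (f := fun _ b => b.tail) (B := fun c => size (l c)) hn hl (by fun_prop)
    hl.size_bounded fun c k _ => by
      rw [hit]
      exact size_suffix_le (List.drop_suffix _ _)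
  simpa [hit] using this

@[fun_prop]
theorem nat_sub {m n : γ → ℕ} (hm : PolyTime m) (hn : PolyTime n) :
    PolyTime fun c => m c - n c := by
  have := (hm.list_replicate_unit.list_drop hn).list_length
  simpa using this

@[fun_prop]
theorem nat_beq {m n : γ → ℕ} (hm : PolyTime m) (hn : PolyTime n) :
    PolyTime fun c => m c == n c := by
  -- Two numbers are equal iff the sum of their two truncated differences is zero.
  have := casesOn_list (g := fun _ => false)
    (((hm.nat_sub hn).nat_add (hn.nat_sub hm)).list_replicate_unit) (const true) (const false)
  refine this.congr fun c => ?_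
  rcases lt_trichotomy (m c) (n c) with h | h | h
  · obtain ⟨k, hk⟩ : ∃ k, m c - n c + (n c - m c) = k + 1 := ⟨n c - m c - 1, by omega⟩
    rw [hk, List.replicate_succ, beq_eq_false_iff_ne.2 h.ne]
  · simp [h]
  · obtain ⟨k, hk⟩ : ∃ k, m c - n c + (n c - m c) = k + 1 := ⟨m c - n c - 1, by omega⟩
    rw [hk, List.replicate_succ, beq_eq_false_iff_ne.2 h.ne']

@[fun_prop]
theorem nat_min {m n : γ → ℕ} (hm : PolyTime m) (hn : PolyTime n) :
    PolyTime fun c => min (m c) (n c) := by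
  have := hm.nat_sub (hm.nat_sub hn)
  refine this.congr fun c => ?_
  omega

@[fun_prop]
theorem list_getD {l : γ → List α} {n : γ → ℕ} {d : γ → α} (hl : PolyTime l) (hn : PolyTime n)
    (hd : PolyTime d) : PolyTime fun c => (l c).getD (n c) (d c) := by
  have := (hl.list_drop hn).list_headD hd
  refine this.congr fun c => ?_
  rw [List.headD_eq_head?_getD, List.head?_drop, List.getD_eq_getElem?_getD]

@[fun_prop]
theorem list_range {n : γ → ℕ} (hn : PolyTime n) : PolyTime fun c => List.range (n c) := by
  have hit (k : ℕ) : (fun b : List ℕ => b.length :: b)^[k] [] = (List.range k).reverse := by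
    induction k with
    | zero => rfl
    | succ k ih => rw [Function.iterate_succ_apply', ih, List.range_succ]; simp
  have := nat_iterate (f := fun _ (b : List ℕ) => b.length :: b) (i := fun _ => [])
    (B := fun c => size (n c) * (size (n c) + 1) + 1) hn (const _) (by fun_prop)
    ((hn.size_bounded.mul (hn.size_bounded.add (.const 1))).add (.const 1)) fun c k hk => by
      rw [hit]
      refine (size_list_le (B := size (n c)) fun a ha => ?_).trans ?_
      · simp at ha ⊢; omega
      · gcongr
        simp; omega
  simpa [hit] using this.list_reverse

end PolyTime

/-! ### Binary arithmetic -/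

/-- The value of a list of bits, least significant bit first. -/
def bitVal (l : List Bool) : ℕ := l.foldr (fun b v => b.toNat + 2 * v) 0

@[simp] theorem bitVal_nil : bitVal [] = 0 := rfl
@[simp] theorem bitVal_cons (b : Bool) (l : List Bool) :
    bitVal (b :: l) = b.toNat + 2 * bitVal l := rfl

theorem bitVal_append (l m : List Bool) : bitVal (l ++ m) = bitVal l + 2 ^ l.length * bitVal m := by
  induction l with
  | nil => simp
  | cons b l ih => simp only [List.cons_append, bitVal_cons, ih, List.length_cons]; ring

theorem bitVal_lt (l : List Bool) : bitVal l < 2 ^ l.length := by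
  induction l with
  | nil => simp
  | cons b l ih =>
    have := b.toNat_le
    simp only [bitVal_cons, List.length_cons, pow_succ]
    omega

theorem bitVal_eq_sum (l : List Bool) : ∀ n, l.length ≤ n →
    bitVal l = ∑ i ∈ Finset.range n, 2 ^ i * (l.getD i false).toNat := by
  induction l with
  | nil => simp
  | cons b l ih =>
    intro n hn
    obtain ⟨n, rfl⟩ : ∃ k, n = k + 1 := ⟨n - 1, by simp at hn; omega⟩
    rw [Finset.sum_range_succ', bitVal_cons, ih n (by simpa using hn), Finset.mul_sum, add_comm]
    simp [pow_succ, mul_assoc, mul_left_comm]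

/-- One step of the schoolbook addition, or of the subtraction if `s` is true. -/
def rippleStep (s : Bool) (l m : List Bool) (x : Bool × List Bool) (i : ℕ) : Bool × List Bool :=
  (((l.getD i false ^^ s) && m.getD i false) ||
      (x.1 && ((l.getD i false ^^ s) ^^ m.getD i false)),
    (l.getD i false ^^ m.getD i false ^^ x.1) :: x.2)

/-- The first `n` steps of an addition or subtraction: the carry, and the bits of the result. -/
def ripple (s : Bool) (l m : List Bool) (n : ℕ) : Bool × List Bool :=
  (List.range n).foldl (rippleStep s l m) (false, [])

theorem ripple_succ (s : Bool) (l m : List Bool) (n : ℕ) :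
    ripple s l m (n + 1) = rippleStep s l m (ripple s l m n) n := by
  simp [ripple, List.range_succ]

theorem length_ripple (s : Bool) (l m : List Bool) (n : ℕ) : (ripple s l m n).2.length = n := by
  induction n with
  | zero => rfl
  | succ n ih => simp [ripple_succ, rippleStep, ih]

/-- The loop invariant of the addition: the digits produced so far, with the carry at position `n`,
represent the sum of the truncated inputs. -/
theorem ripple_add (l m : List Bool) (n : ℕ) :
    bitVal (ripple false l m n).2.reverse + 2 ^ n * (ripple false l m n).1.toNat =
      ∑ i ∈ Finset.range n, 2 ^ i * (l.getD i false).toNat +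
        ∑ i ∈ Finset.range n, 2 ^ i * (m.getD i false).toNat := by
  induction n with
  | zero => rfl
  | succ n ih =>
    have hl := length_ripple false l m n
    rw [Finset.sum_range_succ, Finset.sum_range_succ, ripple_succ]
    simp only [rippleStep, List.reverse_cons, bitVal_append, List.length_reverse, hl]
    rw [add_add_add_comm, ← ih]
    cases l.getD n false <;> cases m.getD n false <;> cases (ripple false l m n).1 <;>
      simp [pow_succ] <;> ring

/-- The same invariant with a borrow, written additively to avoid truncated subtraction. -/
theorem ripple_sub (l m : List Bool) (n : ℕ) :
    bitVal (ripple true l m n).2.reverse + ∑ i ∈ Finset.range n, 2 ^ i * (m.getD i false).toNat =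
      ∑ i ∈ Finset.range n, 2 ^ i * (l.getD i false).toNat +
        2 ^ n * (ripple true l m n).1.toNat := by
  induction n with
  | zero => rfl
  | succ n ih =>
    have hl := length_ripple true l m n
    rw [Finset.sum_range_succ, Finset.sum_range_succ, ripple_succ]
    simp only [rippleStep, List.reverse_cons, bitVal_append, List.length_reverse, hl]
    rw [pow_succ]
    generalize bitVal (ripple true l m n).2.reverse = r at *
    generalize ∑ i ∈ Finset.range n, 2 ^ i * (m.getD i false).toNat = x at *
    generalize ∑ i ∈ Finset.range n, 2 ^ i * (l.getD i false).toNat = y at *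
    generalize 2 ^ n = z at *
    revert ih
    cases l.getD n false <;> cases m.getD n false <;> cases (ripple true l m n).1 <;>
      simp <;> omega

/-- A common number of digits. -/
def bitWidth (l m : List Bool) : ℕ := l.length + (m.length - l.length)

/-- The sum of binary numbers. -/
def addBits (l m : List Bool) : List Bool :=
  (ripple false l m (bitWidth l m)).2.reverse ++ [(ripple false l m (bitWidth l m)).1]

/-- The difference of binary numbers, provided that it is nonnegative. -/
def subBits (l m : List Bool) : List Bool := (ripple true l m (bitWidth l m)).2.reverse

/-- The comparison of binary numbers. -/
def ltBits (l m : List Bool) : Bool := (ripple true l m (bitWidth l m)).1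

theorem length_addBits (l m : List Bool) : (addBits l m).length = max l.length m.length + 1 := by
  simp only [addBits, List.length_append, List.length_reverse, length_ripple, bitWidth,
    List.length_singleton]
  omega

@[simp] theorem bitVal_addBits (l m : List Bool) :
    bitVal (addBits l m) = bitVal l + bitVal m := by
  rw [bitVal_eq_sum l (bitWidth l m) (by unfold bitWidth; omega),
    bitVal_eq_sum m (bitWidth l m) (by unfold bitWidth; omega), ← ripple_add]
  simp [addBits, bitVal_append, length_ripple]

theorem bitVal_ripple_sub (l m : List Bool) :
    bitVal (subBits l m) + bitVal m = bitVal l + 2 ^ bitWidth l m * (ltBits l m).toNat := by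
  rw [bitVal_eq_sum l (bitWidth l m) (by unfold bitWidth; omega),
    bitVal_eq_sum m (bitWidth l m) (by unfold bitWidth; omega)]
  exact ripple_sub l m _

/-- The difference produced is below `2 ^ bitWidth l m`, so a final borrow occurs exactly if the
true difference is negative. -/
theorem ltBits_eq (l m : List Bool) : ltBits l m = decide (bitVal l < bitVal m) := by
  have h₁ := bitVal_ripple_sub l m
  have h₂ := bitVal_lt (subBits l m)
  rw [show (subBits l m).length = bitWidth l m by simp [subBits, length_ripple]] at h₂
  cases h : ltBits l m
  · simp only [h, Bool.toNat_false] at h₁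
    symm
    simp only [decide_eq_false_iff_not]
    omega
  · simp only [h, Bool.toNat_true] at h₁
    symm
    simp only [decide_eq_true_eq]
    omega

theorem bitVal_subBits {l m : List Bool} (h : bitVal m ≤ bitVal l) :
    bitVal (subBits l m) = bitVal l - bitVal m := by
  have h₁ := bitVal_ripple_sub l m
  rw [ltBits_eq, decide_eq_false (by omega)] at h₁
  simp only [Bool.toNat_false] at h₁
  omega

/-- The product of binary numbers. -/
def mulBits (l m : List Bool) : List Bool :=
  l.foldr (fun b x => bif b then addBits (false :: x) m else false :: x) []

@[simp] theorem bitVal_mulBits (l m : List Bool) :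
    bitVal (mulBits l m) = bitVal l * bitVal m := by
  induction l with
  | nil => simp [mulBits]
  | cons b l ih =>
    simp only [mulBits, List.foldr_cons] at ih ⊢
    cases b <;> simp [ih] <;> ring

/-- The coefficient of `m.length` is one. In an iterated product the accumulator is passed as `m`,
so its length grows only additively. -/
theorem length_mulBits (l m : List Bool) : (mulBits l m).length ≤ m.length + 2 * l.length := by
  induction l with
  | nil => simp [mulBits]
  | cons b l ih =>
    simp only [mulBits, List.foldr_cons, List.length_cons] at ih ⊢
    cases b <;> simp [length_addBits] <;> omega

/-- The product of a list of binary numbers. -/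
def prodBits (l : List (List Bool)) : List Bool := l.foldl (fun x y => mulBits y x) [true]

@[simp] theorem bitVal_prodBits (l : List (List Bool)) :
    bitVal (prodBits l) = (l.map bitVal).prod := by
  have (x : List Bool) : bitVal (l.foldl (fun x y => mulBits y x) x) =
      bitVal x * (l.map bitVal).prod := by
    induction l generalizing x with
    | nil => simp
    | cons y l ih => simp only [List.foldl_cons, ih, bitVal_mulBits, List.map_cons, List.prod_cons]; ring
  simp [prodBits, this]

/-- Remove the leading zeros of a binary number. -/
def trimBits (l : List Bool) : List Bool :=
  l.foldr (fun b x => bif b || !(x.length == 0) then b :: x else []) []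

/-- The hypothesis excludes zero, whose encoding is empty and not a single zero digit. -/
theorem encodeNat_bit (b : Bool) (v : ℕ) (h : b = true ∨ v ≠ 0) :
    Computability.encodeNat (b.toNat + 2 * v) = b :: Computability.encodeNat v := by
  obtain ⟨x, rfl⟩ : ∃ x : Num, (x : ℕ) = v := ⟨v, Num.to_of_nat v⟩
  unfold Computability.encodeNat
  have h₂ : ((b.toNat + 2 * (x : ℕ) : ℕ) : Num) = bif b then x.bit1 else x.bit0 := by
    rw [← Num.of_to_nat (bif b then x.bit1 else x.bit0)]
    congr 1
    cases b
    · simp [Num.cast_bit0]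
    · simp [Num.cast_bit1, add_comm]
  rw [h₂, Num.of_to_nat]
  cases x with
  | zero =>
    cases b
    · simp at h
    · rfl
  | pos p => cases b <;> rfl

theorem encodeNat_zero : Computability.encodeNat 0 = [] := rfl

/-- The arithmetic may leave leading zeros. Trimming them gives exactly the canonical encoding that
the output must have. -/
theorem encodeNat_bitVal (l : List Bool) :
    Computability.encodeNat (bitVal l) = trimBits l := by
  induction l with
  | nil => rfl
  | cons b l ih =>
    have e : trimBits (b :: l) =
      bif b || !((trimBits l).length == 0) then b :: trimBits l else [] := rfl
    rw [e, ← ih, bitVal_cons]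
    by_cases h : b = true ∨ bitVal l ≠ 0
    · rw [encodeNat_bit b _ h]
      rcases h with rfl | h
      · rfl
      · have : (Computability.encodeNat (bitVal l)).length ≠ 0 := fun h₀ => h (by
          rw [← Computability.decode_encodeNat (bitVal l), List.length_eq_zero_iff.1 h₀]; rfl)
        rw [beq_eq_false_iff_ne.2 this]; simp
    · push Not at h
      obtain ⟨hb, h⟩ := h
      rw [h]
      cases b
      · simp [encodeNat_zero]
      · exact absurd rfl hb

theorem bitVal_encodeNat (n : ℕ) : bitVal (Computability.encodeNat n) = n := by
  induction n using Nat.strong_induction_on with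
  | _ n ih =>
    rcases Nat.eq_zero_or_pos n with rfl | hn
    · rfl
    have e : (n.bodd).toNat + 2 * (n / 2) = n := by
      rw [← Nat.div2_val]; exact Nat.bodd_add_div2 n
    rw [← e, encodeNat_bit, bitVal_cons, ih _ (by omega)]
    by_contra! h
    rw [h.2] at e
    simp at h
    simp [h.1] at e
    omega

/-! ### Binary arithmetic in polynomial time. -/

namespace PolyTime

@[fun_prop]
theorem bitWidth {l m : γ → List Bool} (hl : PolyTime l) (hm : PolyTime m) :
    PolyTime fun c => bitWidth (l c) (m c) := by
  unfold _root_.bitWidth; fun_prop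

theorem ripple {s : Bool} {l m : γ → List Bool} {n : γ → ℕ} (hl : PolyTime l) (hm : PolyTime m)
    (hn : PolyTime n) : PolyTime fun c => ripple s (l c) (m c) (n c) := by
  refine list_foldl_of_size_le (B := fun _ => 7) (s := fun c => rippleStep s (l c) (m c))
    hn.list_range (const _) ?_ (.const 7) fun c b a _ => ?_
  · have hl' : PolyTime fun x : γ × (Bool × List Bool) × ℕ => l x.1 := by fun_prop
    have hm' : PolyTime fun x : γ × (Bool × List Bool) × ℕ => m x.1 := by fun_prop
    unfold rippleStep; fun_prop
  · obtain ⟨x, y⟩ := b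
    have h₁ := size_bool_le (rippleStep s (l c) (m c) (x, y) a).1
    have h₂ := size_bool_le ((l c).getD a false ^^ (m c).getD a false ^^ x)
    simp only [rippleStep, size_pair, size_cons] at h₁ ⊢
    omega

@[fun_prop]
theorem addBits {l m : γ → List Bool} (hl : PolyTime l) (hm : PolyTime m) :
    PolyTime fun c => addBits (l c) (m c) := by
  have := ripple (s := false) hl hm (hl.bitWidth hm)
  unfold _root_.addBits; fun_prop

@[fun_prop]
theorem subBits {l m : γ → List Bool} (hl : PolyTime l) (hm : PolyTime m) :
    PolyTime fun c => subBits (l c) (m c) := by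
  have := ripple (s := true) hl hm (hl.bitWidth hm)
  unfold _root_.subBits; fun_prop

@[fun_prop]
theorem ltBits {l m : γ → List Bool} (hl : PolyTime l) (hm : PolyTime m) :
    PolyTime fun c => ltBits (l c) (m c) := by
  have := ripple (s := true) hl hm (hl.bitWidth hm)
  unfold _root_.ltBits; fun_prop

theorem _root_.TreeCode.size_bits_le (l : List Bool) : size l ≤ 4 * l.length + 1 := by
  have := size_list_le (l := l) fun b _ => size_bool_le b
  omega

theorem size_bits_le_eval (l : List Bool) :
    size l ≤ (4 * Polynomial.X + 1 : Polynomial ℕ).eval l.length := by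
  simpa using size_bits_le l

theorem length_bounded {l : γ → List α} (hl : PolyTime l) : PolyBounded fun c => (l c).length :=
  hl.size_bounded.mono fun _ => length_le_size _

@[fun_prop]
theorem mulBits {l m : γ → List Bool} (hl : PolyTime l) (hm : PolyTime m) :
    PolyTime fun c => mulBits (l c) (m c) := by
  refine list_foldr_of_measure_le List.length _ size_bits_le_eval
    (s := fun c b x => bif b then _root_.addBits (false :: x) (m c) else false :: x) (i := fun _ => [])
    (B := fun c => (m c).length + 2) hl (const _) (by fun_prop) (.const _)
    (hm.length_bounded.add (.const 2)) fun c x b _ => ?_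
  cases b <;> simp [length_addBits]; omega

@[fun_prop]
theorem prodBits {l : γ → List (List Bool)} (hl : PolyTime l) :
    PolyTime fun c => prodBits (l c) := by
  refine list_foldl_of_measure_le List.length _ size_bits_le_eval
    -- The accumulator is the second factor, the one whose length enters the product bound with
    -- coefficient one.
    (s := fun _ x y => _root_.mulBits y x) (i := fun _ => [true])
    (B := fun c => 2 * size (l c)) hl (const _) (by fun_prop) (.const _)
    ((PolyBounded.const 2).mul hl.size_bounded) fun c x y hy => ?_
  have h₁ := length_mulBits y x
  have h₂ := length_le_size y
  have h₃ := size_le_of_mem hy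
  omega

@[fun_prop]
theorem trimBits {l : γ → List Bool} (hl : PolyTime l) : PolyTime fun c => trimBits (l c) := by
  refine list_foldr_of_size_le
    (s := fun _ b x => bif b || !(x.length == 0) then b :: x else []) (i := fun _ => [])
    (B := fun c => 4) hl (const _) (by fun_prop) (.const _) fun c x b _ => ?_
  have := size_bool_le b
  cases (b || !(x.length == 0)) <;> simp; omega

end PolyTime

/-! ### From functions on lists of symbols to Turing machines -/

/-- The position of a symbol in a list of all symbols. -/
def symIndex : Computability.Γ' → ℕ
  | .bit false => 0
  | .bit true => 1
  | .comma => 2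
  | .bra => 3
  | .ket => 4
  | .blank => 5

instance : TreeCode Computability.Γ' := ⟨fun a => natTree (symIndex a)⟩

theorem code_sym (a : Computability.Γ') : code a = code (symIndex a) := rfl

theorem size_sym_le (a : Computability.Γ') : size a ≤ 11 := by
  change size (symIndex a) ≤ 11
  rw [size_nat]
  rcases a with _ | ⟨_ | _⟩ | _ | _ | _ <;> simp [symIndex]

namespace Prog

/-- Move the input to the working stack, as a list in reverse order. -/
def readInput : Prog :=
  .seq (.push .main false) (.loop .inp Option.isSome fun (o : Option Computability.Γ') =>
    match o with
    | none => .skip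
    | some a => pushWord (true :: code a))

theorem runs_readInput (l : List Computability.Γ') :
    readInput.Runs (tapes l [] [] [] [] [] []) (only (code l.reverse)) (20 * l.length + 2) := by
  have key : ∀ (l L : List Computability.Γ'),
      (Prog.loop .inp Option.isSome fun (o : Option Computability.Γ') =>
        match o with
        | none => .skip
        | some a => pushWord (true :: code a)).Runs (tapes l [] [] (code L) [] [] [])
        (only (code (l.reverse ++ L))) (20 * l.length + 1) := by
    intro l
    induction l with
    | nil => exact fun L => runs_loop_exit (k := .inp) (o := none) rfl rfl (update_inp ..)
    | cons a l ih =>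
      intro L
      have h₀ : (pushWord (true :: code a)).Runs (tapes l [] [] (code L) [] [] [])
          (tapes l [] [] (code (a :: L)) [] [] []) 13 :=
        (runs_pushWord _ _ _ _ _ _ _ _).of_eq (by simp [code_cons]) (by
          have := size_sym_le a
          simp [size] at this ⊢; omega)
      exact (runs_loop_step (k := .inp) (o := some a) rfl rfl (update_inp ..) h₀
        (ih (a :: L))).of_eq (by simp) (by simp; omega)
  have h : (Prog.push .main false).Runs (tapes l [] [] [] [] [] [])
      (tapes l [] [] (code ([] : List Computability.Γ')) [] [] []) 1 :=
    runs_push (k := .main) (update_main ..)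
  exact (h.seq (key l [])).of_eq (by simp) (by omega)

/-- Decode a number `k` from the working stack, and run the `k`-th program of a list. -/
def select : List Prog → Prog
  | [] => .skip
  | p :: l => .popCase .main fun (o : Option Bool) =>
      bif o == some true then .popCase .main fun _ => select l else p

/-- `F` stands for the stacks as a function of the working stack alone, so that one argument serves
both output alphabets. -/
theorem runs_popCase_family {F : List Bool → Tapes} (hF : ∀ m, F m .main = m)
    (hF' : ∀ m m', Function.update (F m) .main m' = F m') {m : List Bool} {x : Bool}
    {f : Option Bool → Prog} {S : Tapes} {T : ℕ} (h : (f (some x)).Runs (F m) S T) :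
    (Prog.popCase .main f).Runs (F (x :: m)) S (T + 1) :=
  runs_popCase (k := .main) (o := some x) (by rw [hF]; rfl) (by rw [hF', hF]; rfl) h

theorem runs_select {F : List Bool → Tapes} (hF : ∀ m, F m .main = m)
    (hF' : ∀ m m', Function.update (F m) .main m' = F m') {m : List Bool} {S : Tapes} {T : ℕ}
    {p : Prog} (h : p.Runs (F m) S T) : ∀ {k : ℕ} {l : List Prog}, l[k]? = some p →
      (select l).Runs (F (code k ++ m)) S (T + (2 * k + 1)) := by
  intro k
  induction k with
  | zero =>
    intro l hl
    obtain ⟨q, l, rfl⟩ : ∃ q l', l = q :: l' := by cases l <;> simp at hl ⊢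
    obtain rfl : q = p := by simpa using hl
    exact runs_popCase_family hF hF' (x := false) h
  | succ k ih =>
    intro l hl
    obtain ⟨q, l, rfl⟩ : ∃ q l', l = q :: l' := by cases l <;> simp at hl ⊢
    exact (runs_popCase_family hF hF' (x := true) (runs_popCase_family hF hF'
      (ih (l := l) (by simpa using hl)))).mono (by omega)

/-- Decode a list from the working stack, running a program for each member. -/
def writeOutput (l : List Prog) : Prog :=
  .loop .main (fun (o : Option Bool) => o == some true) fun _ => select l

theorem runs_writeOutput {Ω : Type} [TreeCode Ω] {idx : Ω → ℕ} (hidx : ∀ a, code a = code (idx a))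
    (hidx' : ∀ a, idx a ≤ 5) {F : List Ω → List Bool → Tapes} (hF : ∀ o m, F o m .main = m)
    (hF' : ∀ o m m', Function.update (F o m) .main m' = F o m') {ps : List Prog}
    (hps : ∀ a, ∃ p, ps[idx a]? = some p ∧ ∀ o m, p.Runs (F o m) (F (a :: o) m) 1)
    (l : List Ω) : ∀ o, (writeOutput ps).Runs (F o (code l)) (F (l.reverse ++ o) [])
      (20 * l.length + 1) := by
  induction l with
  | nil =>
    intro o
    exact runs_loop_exit (k := .main) (S := F o (code ([] : List Ω))) (o := some false)
      (by rw [hF]; rfl) rfl (by rw [hF', hF]; rfl)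
  | cons a l ih =>
    intro o
    obtain ⟨p, hp, hp'⟩ := hps a
    have h := runs_select (F := F o) (hF o) (hF' o) (hp' o (code l)) hp
    refine (runs_loop_step (k := .main) (S := F o (code (a :: l))) (o := some true)
      (by rw [hF]; rfl) rfl (by rw [hF', hF]; rfl)
      (hidx a ▸ h) (ih (a :: o))).of_eq (by simp) ?_
    have := hidx' a
    simp only [List.length_cons]
    omega

end Prog

open Prog in
theorem polyTimeComputable_of_runs {α β Ω : Type} [TreeCode Ω] {ea : α → List Computability.Γ'}
    {f : α → β} {k₁ : Tape} {eb : β → List k₁.Sym} (φ : Ω ≃ k₁.Sym)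
    {F : List Computability.Γ' → List Ω} (hF : PolyTime F)
    (h : ∀ a, (F (ea a)).map φ = eb (f a)) {w : Prog}
    (hw : ∀ l : List Ω, w.Runs (only (code l))
      (Function.update (fun _ => []) k₁ (l.reverse.map φ)) (20 * l.length + 1)) :
    PolyTimeComputable ea eb f := by
  -- Reading the input reverses it, and writing the output reverses that; both are undone here.
  have hG : PolyTime fun l : List Computability.Γ' => (F l.reverse).reverse := by
    have : PolyTime fun l : List Computability.Γ' => F l.reverse := hF.comp (by fun_prop)
    fun_prop
  obtain ⟨p, P, hp⟩ := hG
  let q := Prog.seq readInput (.seq p w)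
  -- Reading costs 20 steps per symbol. A symbol has code length at most 11, so the list has size at
  -- most 12 times its length plus 1. The middle phase costs `P` and the writing at most 20 times
  -- `P`. One unit is kept for the halting step.
  let Q : Polynomial ℕ := 20 * Polynomial.X + 2 + 21 * P.comp (12 * Polynomial.X + 1) + 2
  have run (a : α) : q.Runs (tapes (ea a) [] [] [] [] [] [])
      (Function.update (fun _ => []) k₁ (eb (f a))) (Q.eval (ea a).length - 1) := by
    have h₁ := runs_readInput (ea a)
    obtain ⟨hs, hr⟩ := hp (ea a).reverse
    have h₂ := hr []
    simp only [List.reverse_reverse] at h₂ hs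
    rw [List.append_nil, List.append_nil] at h₂
    have h₃ := hw (F (ea a)).reverse
    rw [List.reverse_reverse, h] at h₃
    refine (h₁.seq (h₂.seq h₃)).mono ?_
    have h₄ := length_le_size (F (ea a)).reverse
    have h₅ : size (ea a).reverse ≤ 12 * (ea a).length + 1 := by
      have := size_list_le (l := (ea a).reverse) (B := 11) fun a _ => size_sym_le a
      simp at this ⊢; omega
    have h₆ := P.eval_le_eval_nat h₅
    simp only [Q, Polynomial.eval_add, Polynomial.eval_mul, Polynomial.eval_comp,
      Polynomial.eval_ofNat, Polynomial.eval_X, Polynomial.eval_one]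
    omega
  have out (a : α) : Nonempty (Turing.TM2OutputsInTime (q.machine k₁) (ea a) (some (eb (f a)))
      (Q.eval (ea a).length)) := by
    obtain ⟨t, ht, he⟩ := run a
    refine machine_outputs he rfl rfl ?_
    have : 0 < Q.eval (ea a).length := by simp [Q]
    omega
  exact ⟨⟨⟨q.machine k₁, Equiv.refl _, Equiv.refl _⟩, Q, fun a => by
    have e₁ : List.map (Equiv.refl Computability.Γ').invFun (ea a) = ea a := List.map_id _
    have e₂ : List.map (Equiv.refl k₁.Sym).invFun (eb (f a)) = eb (f a) := List.map_id _
    exact Eq.mpr (congrArg₂ (fun x y => Turing.TM2OutputsInTime (q.machine k₁) x (some y)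
      (Q.eval (ea a).length)) e₁ e₂) (out a).some⟩⟩

theorem polyTimeComputable_of_polyTime {α β : Type} {ea : α → List Computability.Γ'} {f : α → β}
    {eb : β → List Computability.Γ'} {F : List Computability.Γ' → List Computability.Γ'}
    (hF : PolyTime F) (h : ∀ a, F (ea a) = eb (f a)) : PolyTimeComputable ea eb f := by
  refine polyTimeComputable_of_runs (k₁ := .outSym) (Equiv.refl Computability.Γ') hF
    (fun a => (List.map_id _).trans (h a))
    (w := Prog.writeOutput [.push .outSym (.bit false), .push .outSym (.bit true),
      .push .outSym .comma, .push .outSym .bra, .push .outSym .ket, .push .outSym .blank])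
    fun l => ?_
  refine (Prog.runs_writeOutput (idx := symIndex) (F := fun o m => Prog.tapes [] o [] m [] [] [])
    code_sym (fun a => ?_) (fun _ _ => rfl) (fun _ _ _ => Prog.update_main ..)
    (fun a => ?_) l []).of_eq ?_ le_rfl
  · rcases a with _ | ⟨_ | _⟩ | _ | _ | _ <;> simp [symIndex]
  · rcases a with _ | ⟨_ | _⟩ | _ | _ | _ <;>
      exact ⟨_, rfl, fun _ _ => Prog.runs_push (Prog.update_outSym ..)⟩
  · refine Eq.trans ?_ (congrArg _ (List.map_id _).symm)
    funext k
    cases k <;> simp <;> rfl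

open Classical in
theorem polyTimeDecidable_of_polyTime {α : Type} {ea : α → List Computability.Γ'} {p : α → Prop}
    {F : List Computability.Γ' → Bool} (hF : PolyTime F) (h : ∀ a, F (ea a) = true ↔ p a) :
    PolyTimeDecidable ea p := by
  refine polyTimeComputable_of_runs (k₁ := .outBool) (F := fun l => [F l]) (Equiv.refl Bool)
    (by fun_prop) (fun a => ?_)
    (w := Prog.writeOutput [.push .outBool false, .push .outBool true])
    fun l => ?_
  · have : F (ea a) = decide (p a) := by
      rw [Bool.eq_iff_iff, h, decide_eq_true_iff]
    rw [this]
    rfl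
  refine (Prog.runs_writeOutput (idx := Bool.toNat) (F := fun o m => Prog.tapes [] [] o m [] [] [])
    (fun a => ?_) (fun a => ?_) (fun _ _ => rfl) (fun _ _ _ => Prog.update_main ..)
    (fun a => ?_) l []).of_eq ?_ le_rfl
  · cases a <;> rfl
  · cases a <;> simp
  · cases a <;> exact ⟨_, rfl, fun _ _ => Prog.runs_push (Prog.update_outBool ..)⟩
  · refine Eq.trans ?_ (congrArg _ (List.map_id _).symm)
    funext k
    cases k <;> simp <;> rfl

/-! ### Winning coalitions -/

namespace TransitionSystem

variable {S : Type*} {TS : TransitionSystem S} {ρ : List S}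

theorem IsCounterexample.init_eq (h : TS.IsCounterexample ρ) (h₀ : 0 < ρ.length) :
    ρ[0] = TS.init := by
  obtain ⟨r, hr, hp⟩ := h.prefix_of_run
  rw [hp 0 h₀, hr.1]

theorem IsCounterexample.trans_succ (h : TS.IsCounterexample ρ) {i : ℕ} (hi : i + 1 < ρ.length) :
    TS.trans ρ[i] ρ[i + 1] := by
  obtain ⟨r, hr, hp⟩ := h.prefix_of_run
  rw [hp i (by omega), hp (i + 1) hi]
  exact hr.2 i

theorem IsCounterexample.length_pos (h : TS.IsCounterexample ρ) : 0 < ρ.length :=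
  List.length_pos_of_ne_nil h.ne_nil

theorem IsCounterexample.bad_iff (h : TS.IsCounterexample ρ) {i : ℕ} (hi : i < ρ.length) :
    ρ[i] ∈ TS.bad ↔ i + 1 = ρ.length := by
  constructor
  · intro hb
    by_contra hne
    exact h.not_bad_before i (by omega) hb
  · intro hi'
    have := h.last_bad
    rw [List.getLast_eq_getElem] at this
    convert this using 2
    omega

/-- The transitions of the game in which the states of `ρ` outside `C` are engraved. -/
def Edge (TS : TransitionSystem S) (ρ : List S) (C : Set S) (u v : S) : Prop :=
  (u ∉ C ∧ ∃ (i : ℕ) (hi : i + 1 < ρ.length), u = ρ[i] ∧ v = ρ[i + 1]) ∨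
    (TS.trans u v ∧ (u ∉ ρ ∨ u ∈ C))

/-- A set of states that are not bad, in which a play can always continue unless it stops. -/
def IsSafeRegion (TS : TransitionSystem S) (ρ : List S) (C X : Set S) : Prop :=
  ∀ u ∈ X, u ∉ TS.bad ∧ ((∃ v, TS.Edge ρ C u v) → ∃ v ∈ X, TS.Edge ρ C u v)

/-- Giving Safe the states off ρ changes who moves there, but no transition. -/
theorem engravedGame_trans_iff (C : Set S) (u v : S) :
    (TS.engravedGame ρ (C ∪ {s | s ∉ ρ})).trans u v ↔ TS.Edge ρ C u v := by
  have h (i : ℕ) (hi : i + 1 < ρ.length) : ρ[i] ∈ ρ := List.getElem_mem _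
  simp only [engravedGame, Edge, Set.mem_union, Set.mem_ofPred_eq]
  constructor
  · rintro (⟨h₁, h₂⟩ | h₁)
    · exact Or.inl ⟨fun h => h₁ (Or.inl h), h₂⟩
    · exact Or.inr (by tauto)
  · rintro (⟨h₁, i, hi, rfl, rfl⟩ | h₁)
    · exact Or.inl ⟨by simp [h₁, h i hi], i, hi, rfl, rfl⟩
    · exact Or.inr (by tauto)

open Classical in
-- From a winning strategy, the states visited in one play form the region. From a region, Safe
-- stays inside, and Reach cannot leave because the engraved transition is his only one.
theorem IsCounterexample.safeWins_iff (h : TS.IsCounterexample ρ) (C : Set S) :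
    (TS.engravedGame ρ (C ∪ {s | s ∉ ρ})).SafeWins ↔
      ∃ X, TS.init ∈ X ∧ TS.IsSafeRegion ρ C X := by
  set G := TS.engravedGame ρ (C ∪ {s | s ∉ ρ}) with hG
  have hE (u v : S) : G.trans u v ↔ TS.Edge ρ C u v := engravedGame_trans_iff C u v
  constructor
  · rintro ⟨σ, hσ, hwin⟩
    -- Any legal strategy of Reach will do; one is needed only to obtain a play.
    let τ : S → S := fun u => if h : ∃ v, G.trans u v then h.choose else u
    have hτ : G.IsReachStrategy τ := fun u _ hu => by
      simp only [τ, dif_pos hu]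
      exact hu.choose_spec
    refine ⟨Set.range (G.play σ τ), ⟨0, rfl⟩, ?_⟩
    rintro _ ⟨i, rfl⟩
    refine ⟨hwin τ hτ i, fun hu => ⟨_, ⟨i + 1, rfl⟩, ?_⟩⟩
    have hu' : ∃ v, G.trans (G.play σ τ i) v := by simpa only [hE] using hu
    rw [← hE, SafetyGame.play, if_pos hu']
    split_ifs with hs
    · exact hσ _ hs hu'
    · exact hτ _ hs hu'
  · rintro ⟨X, h₀, hX⟩
    -- Outside `X` the choice is arbitrary but must be legal, hence the second case.
    let σ : S → S := fun u =>
      if h : ∃ v ∈ X, G.trans u v then h.choose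
      else if h : ∃ v, G.trans u v then h.choose else u
    have hσX (u : S) (hu : u ∈ X) (h : ∃ v, G.trans u v) : σ u ∈ X ∧ G.trans u (σ u) := by
      have : ∃ v ∈ X, G.trans u v := by simpa only [hE] using (hX u hu).2 (by simpa only [hE] using h)
      simp only [σ, dif_pos this]
      exact this.choose_spec
    refine ⟨σ, fun u _ hu => ?_, fun τ hτ i => ?_⟩
    · by_cases h' : ∃ v ∈ X, G.trans u v
      · simp only [σ, dif_pos h']
        exact h'.choose_spec.2
      · simp only [σ, dif_neg h', dif_pos hu]
        exact hu.choose_spec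
    · suffices G.play σ τ i ∈ X from (hX _ this).1
      induction i with
      | zero => exact h₀
      | succ i ih =>
        rw [SafetyGame.play]
        split_ifs with hu hs
        · exact (hσX _ ih hu).1
        · have h₁ := hτ _ hs hu
          obtain ⟨h₂, h₃⟩ := hσX _ ih hu
          have hs' : G.play σ τ i ∉ C ∧ G.play σ τ i ∈ ρ := by simpa [hG, engravedGame] using hs
          rw [hE] at h₁ h₃
          rcases h₁ with ⟨_, j, hj, h₄, h₅⟩ | ⟨_, h₁⟩
          · rcases h₃ with ⟨_, k, hk, h₆, h₇⟩ | ⟨_, h₃⟩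
            -- Distinctness of the states of ρ makes the engraved transition unique, so the move of
            -- Reach agrees with the one into `X`.
            · have : j = k := (h.nodup.getElem_inj_iff).1 (h₄.symm.trans h₆)
              subst this
              rw [h₅, ← h₇]
              exact h₂
            · tauto
          · tauto
        · exact ih

/-- The winning singleton is the last state of ρ in `X`. It lies in `C`, since otherwise its
engraved successor would be a later state of ρ in `X`. With this state alone, Safe lets the play
follow ρ up to it and continues inside `X`. -/
theorem IsCounterexample.exists_safeRegion_singleton (h : TS.IsCounterexample ρ) {C X : Set S}
    (h₀ : TS.init ∈ X) (hX : TS.IsSafeRegion ρ C X) :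
    ∃ s ∈ C, ∃ Y, TS.init ∈ Y ∧ TS.IsSafeRegion ρ {s} Y := by
  classical
  have hpos := h.length_pos
  let P : ℕ → Prop := fun i => ∃ hi : i < ρ.length, ρ[i] ∈ X
  set i := Nat.findGreatest P ρ.length with hi
  have hPi : P i := Nat.findGreatest_spec (Nat.zero_le _) ⟨hpos, by rwa [h.init_eq hpos]⟩
  have hmax (j : ℕ) (hj : i < j) : ¬ P j := fun hPj =>
    Nat.findGreatest_is_greatest hj hPj.1.le hPj
  obtain ⟨hil, hiX⟩ := hPi
  have hnb (j : ℕ) (hj : j < ρ.length) (hji : j ≤ i) : ρ[j] ∉ TS.bad := by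
    rw [h.bad_iff]
    have := (hX _ hiX).1
    rw [h.bad_iff] at this
    omega
  have hi' : i + 1 < ρ.length := by
    have := hnb i hil le_rfl
    rw [h.bad_iff] at this
    omega
  have hsucc : ρ[i + 1] ∉ X := fun h' => hmax (i + 1) (by omega) ⟨hi', h'⟩
  have hiC : ρ[i] ∈ C := by
    by_contra hC
    obtain ⟨v, hv, hE⟩ := (hX _ hiX).2 ⟨ρ[i + 1], Or.inl ⟨hC, i, hi', rfl, rfl⟩⟩
    rcases hE with ⟨_, j, hj, h₁, h₂⟩ | ⟨_, h₁⟩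
    · have : i = j := (h.nodup.getElem_inj_iff).1 h₁
      subst this
      exact hsucc (h₂ ▸ hv)
    · exact h₁.elim (fun h' => h' (List.getElem_mem _)) hC
  -- The initial segment of ρ is added because its states, possibly in `C` before, are now engraved
  -- and lead to `ρ[i]`.
  refine ⟨ρ[i], hiC, X ∪ {u | ∃ (j : ℕ) (hj : j < ρ.length), j ≤ i ∧ u = ρ[j]}, Or.inl h₀, ?_⟩
  have hρ (j : ℕ) (hj : j < ρ.length) (hji : j ≤ i) : ρ[j] ∉ TS.bad ∧
      ((∃ v, TS.Edge ρ {ρ[i]} ρ[j] v) →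
        ∃ v ∈ X ∪ {u | ∃ (j : ℕ) (hj : j < ρ.length), j ≤ i ∧ u = ρ[j]},
          TS.Edge ρ {ρ[i]} ρ[j] v) := by
    refine ⟨hnb j hj hji, fun _ => ?_⟩
    rcases hji.eq_or_lt with rfl | hji
    · obtain ⟨v, hv, hE⟩ := (hX _ hiX).2 ⟨ρ[i + 1], Or.inr ⟨h.trans_succ hi', Or.inr hiC⟩⟩
      refine ⟨v, Or.inl hv, Or.inr ⟨?_, Or.inr rfl⟩⟩
      rcases hE with ⟨h₁, _⟩ | ⟨h₁, _⟩
      · exact absurd hiC h₁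
      · exact h₁
    · refine ⟨ρ[j + 1], Or.inr ⟨j + 1, by omega, by omega, rfl⟩, Or.inl ⟨?_, j, by omega, rfl, rfl⟩⟩
      rw [Set.mem_singleton_iff, h.nodup.getElem_inj_iff]
      omega
  rintro u (hu | ⟨j, hj, hji, rfl⟩)
  · by_cases huρ : u ∈ ρ
    · obtain ⟨j, hj, rfl⟩ := List.getElem_of_mem huρ
      exact hρ j hj (not_lt.1 fun hji => hmax j hji ⟨hj, hu⟩)
    · refine ⟨(hX u hu).1, fun ⟨v, hv⟩ => ?_⟩
      -- The transitions of a state off ρ do not depend on the coalition.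
      have key (D D' : Set S) (w : S) (hw : TS.Edge ρ D u w) : TS.Edge ρ D' u w := by
        rcases hw with ⟨_, j, hj, rfl, _⟩ | ⟨h₁, _⟩
        · exact absurd (List.getElem_mem _) huρ
        · exact Or.inr ⟨h₁, Or.inl huρ⟩
      obtain ⟨w, hw, hE⟩ := (hX u hu).2 ⟨v, key _ _ v hv⟩
      exact ⟨w, Or.inl hw, key _ _ w hE⟩
  · exact hρ j hj hji

/-- Engraved transitions are genuine ones, so a larger coalition only gains moves. -/
theorem IsCounterexample.isSafeRegion_mono (h : TS.IsCounterexample ρ) {C D X : Set S}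
    (hCD : C ⊆ D) (hX : TS.IsSafeRegion ρ C X) : TS.IsSafeRegion ρ D X := by
  have mono {u v : S} (hE : TS.Edge ρ C u v) : TS.Edge ρ D u v := by
    by_cases hu : u ∈ D
    · refine Or.inr ⟨?_, Or.inr hu⟩
      rcases hE with ⟨_, i, hi, rfl, rfl⟩ | ⟨h₁, _⟩
      · exact h.trans_succ hi
      · exact h₁
    · rcases hE with ⟨_, h₁⟩ | ⟨h₁, h₂⟩
      · exact Or.inl ⟨hu, h₁⟩
      · exact Or.inr ⟨h₁, h₂.imp id fun h => absurd (hCD h) hu⟩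
  refine fun u hu => ⟨(hX u hu).1, fun ⟨v, hv⟩ => ?_⟩
  -- A state that stops for `C` but not for `D` would break the argument. Engraving removes all
  -- moves only at the end of ρ, which is bad and thus not in `X`.
  have : ∃ v, TS.Edge ρ C u v := by
    by_cases huρ : u ∈ ρ
    · by_cases huC : u ∈ C
      · rcases hv with ⟨h₁, _⟩ | ⟨h₁, _⟩
        · exact absurd (hCD huC) h₁
        · exact ⟨v, Or.inr ⟨h₁, Or.inr huC⟩⟩
      · obtain ⟨i, hi, rfl⟩ := List.getElem_of_mem huρ
        have := (hX _ hu).1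
        rw [h.bad_iff] at this
        exact ⟨_, Or.inl ⟨huC, i, by omega, rfl, rfl⟩⟩
    · rcases hv with ⟨_, j, hj, rfl, _⟩ | ⟨h₁, _⟩
      · exact absurd (List.getElem_mem _) huρ
      · exact ⟨v, Or.inr ⟨h₁, Or.inl huρ⟩⟩
  obtain ⟨w, hw, hE⟩ := (hX u hu).2 this
  exact ⟨w, hw, mono hE⟩

/-- A state that wins on its own. -/
def IsWinning (TS : TransitionSystem S) (ρ : List S) (s : S) : Prop :=
  ∃ X, TS.init ∈ X ∧ TS.IsSafeRegion ρ {s} X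

open Classical in
theorem IsCounterexample.optimisticGame_eq (h : TS.IsCounterexample ρ) (C : Finset S) :
    TS.optimisticGame ρ C = if ∃ s ∈ C, TS.IsWinning ρ s then 1 else 0 := by
  rw [optimisticGame]
  congr 1
  rw [h.safeWins_iff]
  refine propext ⟨fun ⟨X, h₀, hX⟩ => ?_, fun ⟨s, hs, X, h₀, hX⟩ => ⟨X, h₀,
    h.isSafeRegion_mono (Set.singleton_subset_iff.2 hs) hX⟩⟩
  obtain ⟨s, hs, hY⟩ := h.exists_safeRegion_singleton h₀ hX
  exact ⟨s, hs, hY⟩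

end TransitionSystem

/-! ### Power indices of disjunctive games. -/

/-- The marginal contribution of `i` is 1 exactly if `i ∈ W` and the coalition is disjoint from `W`.
Such coalitions are the subsets of `Wᶜ`, and they are counted by cardinality. -/
theorem powerIndex_of_disjunction {X : Type*} [Fintype X] [DecidableEq X] (q : ℕ → ℝ)
    (W : Finset X) {v : Finset X → ℝ} (hv : ∀ C, v C = if ∃ s ∈ C, s ∈ W then 1 else 0) (i : X) :
    powerIndex (fun k => q k) v i = if i ∈ W then
      ∑ k ∈ Finset.range (Wᶜ.card + 1), (Wᶜ.card.choose k : ℝ) * q k else 0 := by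
  have key (C : Finset X) : v (insert i C) - v C =
      if i ∈ W then (if C ⊆ Wᶜ then 1 else 0) else 0 := by
    have hC : C ⊆ Wᶜ ↔ ¬ ∃ s ∈ C, s ∈ W := by simp [Finset.subset_iff]
    rw [hv, hv]
    by_cases hi : i ∈ W
    · by_cases h : ∃ s ∈ C, s ∈ W <;> simp [hC, h, hi]
    · simp [hi]
  unfold powerIndex
  simp only [key]
  split_ifs with hi
  · rw [← Finset.sum_subtype (Finset.univ.filter fun C : Finset X => i ∉ C) (by simp)
      (fun C => q C.card * if C ⊆ Wᶜ then 1 else 0)]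
    simp only [mul_ite, mul_one, mul_zero, ← Finset.sum_filter, Finset.filter_filter]
    simp_rw [← nsmul_eq_mul, ← Finset.sum_powerset_apply_card]
    refine Finset.sum_congr ?_ fun _ _ => rfl
    ext C
    simp only [Finset.mem_filter, Finset.mem_univ, true_and, Finset.mem_powerset,
      and_iff_right_iff_imp]
    -- A subset of `Wᶜ` cannot contain `i`, so the condition `i ∉ C` is automatic.
    intro h hC
    simpa [hi] using h hC
  · simp

/-! ### The algorithm -/

/-- The input, split at the commas. -/
abbrev Tokens : Type := List (List Computability.Γ')

namespace Tokens

/-- Split a list of symbols at the commas. -/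
def split (l : List Computability.Γ') : Tokens :=
  l.foldr (fun a ts => bif symIndex a == 2 then [] :: ts else (a :: ts.headD []) :: ts.tail) []

/-- The bits of a token. -/
def bits (t : List Computability.Γ') : List Bool :=
  (t.filter fun a => symIndex a == 0 || symIndex a == 1).map fun a => symIndex a == 1

/-- The value of a binary number, provided that it is at most `n`. -/
def cappedVal (n : ℕ) (l : List Bool) : ℕ :=
  l.foldr (fun b v => min n (bif b then v + v + 1 else v + v)) 0

variable (ts : Tokens)

/-- The number of states. -/
def states : ℕ := (ts.getD 1 []).length

/-- The adjacency matrix. -/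
def adj (i j : ℕ) : Bool := symIndex ((ts.getD (i + 1) []).getD j .blank) == 1

/-- The indicator of the bad states. -/
def isBad (i : ℕ) : Bool := symIndex ((ts.getD (ts.states + 2) []).getD i .blank) == 1

/-- The tokens of the counterexample. -/
def pathTokens : Tokens :=
  (ts.drop (ts.states + 3)).takeWhile fun t => !(symIndex (t.headD .blank) == 4)

/-- The counterexample. -/
def path : List ℕ := ts.pathTokens.map fun t => cappedVal ts.states (bits t)

/-- The position of the token of the state in question. -/
def statePos : ℕ := ts.states + 3 + ts.pathTokens.length

/-- The state in question. -/
def state : ℕ := cappedVal ts.states (bits (ts.getD ts.statePos []))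

/-- The sign bit and the numerator of the `k`-th fraction. -/
def signedNum (k : ℕ) : List Bool := bits (ts.getD (ts.statePos + 1 + (k + k)) [])

/-- Whether the `k`-th fraction is negative. -/
def isNeg (k : ℕ) : Bool := (ts.signedNum k).headD false

/-- The absolute value of the numerator of the `k`-th fraction. -/
def num (k : ℕ) : List Bool := (ts.signedNum k).tail

/-- The denominator of the `k`-th fraction. -/
def den (k : ℕ) : List Bool := bits (ts.getD (ts.statePos + 2 + (k + k)) [])

/-- The transitions of the game in which Safe controls `s` and the states off the path. -/
def edge (s u v : ℕ) : Bool :=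
  bif ts.path.any (fun w => w == u) && !(u == s) then
    (List.range ts.path.length).any fun i =>
      ts.path.getD i ts.states == u && ts.path.getD (i + 1) ts.states == v
  else ts.adj u v

/-- One round of the computation of the safe region. -/
def regionStep (s : ℕ) (X : List Bool) : List Bool :=
  (List.range ts.states).map fun u => !ts.isBad u && (X.getD u false &&
    ((List.range ts.states).any (fun v => ts.edge s u v && X.getD v false) ||
      !(List.range ts.states).any fun v => ts.edge s u v))

/-- The states from which a play can avoid the bad states, in the game for `s`. -/
def region (s : ℕ) : List Bool :=
  (ts.regionStep s)^[ts.states] ((List.range ts.states).map fun _ => true)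

/-- Whether Safe wins if she controls `s` and the states off the path. -/
def winning (s : ℕ) : Bool := (ts.region s).getD (ts.path.headD ts.states) false

/-- The number of states that do not win on their own. -/
def losers : ℕ := ((List.range ts.states).filter fun s => !ts.winning s).length

/-- The common denominator of the weights. -/
def commonDen : List Bool := prodBits ((List.range ts.states).map fun k => ts.den k)

/-- The absolute value of the numerator of the `k`-th weight over the common denominator. -/
def commonNum (k : ℕ) : List Bool :=
  mulBits (ts.num k) (prodBits (((List.range ts.states).filter fun j => !(j == k)).map
    fun j => ts.den j))

/-- The numerators of sign `s`. -/
def signPart (s : Bool) : List (List Bool) :=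
  (List.range ts.states).map fun k => bif ts.isNeg k ^^ s then [] else ts.commonNum k

/-- Add to each number its successor in the list. -/
def pascalStep (n : ℕ) (l : List (List Bool)) : List (List Bool) :=
  (List.range n).map fun k => addBits (l.getD k []) (l.getD (k + 1) [])

/-- The sum of the first `n` numbers of `l`, weighted by binomial coefficients `m.choose k`. -/
def binomSum (n m : ℕ) (l : List (List Bool)) : List Bool := ((pascalStep n)^[m] l).headD []

/-- The sum of the contributions of the weights of sign `s`, over the common denominator. -/
def part (s : Bool) : List Bool :=
  bif ts.winning ts.state then binomSum ts.states ts.losers (ts.signPart s) else []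

/-- Whether the responsibility is positive. -/
def positive : Bool := ltBits (ts.part true) (ts.part false)

/-- Whether the responsibility exceeds the fraction that follows the weights. -/
def exceeds : Bool :=
  ltBits (addBits (mulBits (ts.num ts.states) ts.commonDen)
    (mulBits (ts.part true) (ts.den ts.states))) (mulBits (ts.part false) (ts.den ts.states))

/-- The symbols of a binary number, without leading zeros, ended by a comma. -/
def writeBits (l : List Bool) : List Computability.Γ' :=
  ((trimBits l).map fun b => bif b then .bit true else .bit false) ++ [.comma]

/-- The responsibility as a fraction. -/
def output : List Computability.Γ' :=
  (bif ltBits (ts.part false) (ts.part true) then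
    .bit true :: writeBits (subBits (ts.part true) (ts.part false))
  else .bit false :: writeBits (subBits (ts.part false) (ts.part true))) ++ writeBits ts.commonDen

end Tokens

/-! ### Polynomial running time of the algorithm. -/

namespace PolyTime

@[fun_prop]
theorem symIndex {a : γ → Computability.Γ'} (ha : PolyTime a) : PolyTime fun c => symIndex (a c) :=
  comp (g := _root_.symIndex) (of_code_eq fun _ => rfl) ha

@[fun_prop]
theorem split {l : γ → List Computability.Γ'} (hl : PolyTime l) :
    PolyTime fun c => Tokens.split (l c) := by
  refine list_foldr_of_size_le (B := fun _ => 14)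
    (s := fun _ a (ts : Tokens) => bif _root_.symIndex a == 2 then [] :: ts
      else (a :: ts.headD []) :: ts.tail) (i := fun _ => [])
    hl (const _) (by fun_prop) (.const _) fun c ts a _ => ?_
  have := size_sym_le a
  cases _root_.symIndex a == 2
  · cases ts <;> simp <;> omega
  · simp; omega

@[fun_prop]
theorem bits {l : γ → List Computability.Γ'} (hl : PolyTime l) :
    PolyTime fun c => Tokens.bits (l c) := by
  unfold Tokens.bits; fun_prop

-- Turning binary into unary is exponential in general. The cap `n` keeps every intermediate value
-- small.
@[fun_prop]
theorem cappedVal {n : γ → ℕ} {l : γ → List Bool} (hn : PolyTime n) (hl : PolyTime l) :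
    PolyTime fun c => Tokens.cappedVal (n c) (l c) := by
  refine list_foldr_of_size_le (B := fun c => size (n c))
    (s := fun c b v => min (n c) (bif b then v + v + 1 else v + v)) (i := fun _ => 0)
    hl (const _) (by fun_prop) hn.size_bounded fun c ts a _ => ?_
  simp; omega

variable {ts : γ → Tokens}

@[fun_prop]
theorem states (h : PolyTime ts) : PolyTime fun c => (ts c).states := by
  unfold Tokens.states; fun_prop

@[fun_prop]
theorem adj {i j : γ → ℕ} (h : PolyTime ts) (hi : PolyTime i) (hj : PolyTime j) :
    PolyTime fun c => (ts c).adj (i c) (j c) := by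
  unfold Tokens.adj; fun_prop

@[fun_prop]
theorem isBad {i : γ → ℕ} (h : PolyTime ts) (hi : PolyTime i) :
    PolyTime fun c => (ts c).isBad (i c) := by
  unfold Tokens.isBad; fun_prop

@[fun_prop]
theorem pathTokens (h : PolyTime ts) : PolyTime fun c => (ts c).pathTokens := by
  unfold Tokens.pathTokens; fun_prop

@[fun_prop]
theorem path (h : PolyTime ts) : PolyTime fun c => (ts c).path := by
  unfold Tokens.path; fun_prop

@[fun_prop]
theorem statePos (h : PolyTime ts) : PolyTime fun c => (ts c).statePos := by
  unfold Tokens.statePos; fun_prop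

@[fun_prop]
theorem state (h : PolyTime ts) : PolyTime fun c => (ts c).state := by
  unfold Tokens.state; fun_prop

@[fun_prop]
theorem signedNum {k : γ → ℕ} (h : PolyTime ts) (hk : PolyTime k) :
    PolyTime fun c => (ts c).signedNum (k c) := by
  unfold Tokens.signedNum; fun_prop

@[fun_prop]
theorem isNeg {k : γ → ℕ} (h : PolyTime ts) (hk : PolyTime k) :
    PolyTime fun c => (ts c).isNeg (k c) := by
  unfold Tokens.isNeg; fun_prop

@[fun_prop]
theorem num {k : γ → ℕ} (h : PolyTime ts) (hk : PolyTime k) :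
    PolyTime fun c => (ts c).num (k c) := by
  unfold Tokens.num; fun_prop

@[fun_prop]
theorem den {k : γ → ℕ} (h : PolyTime ts) (hk : PolyTime k) :
    PolyTime fun c => (ts c).den (k c) := by
  unfold Tokens.den; fun_prop

@[fun_prop]
theorem edge {s u v : γ → ℕ} (h : PolyTime ts) (hs : PolyTime s) (hu : PolyTime u)
    (hv : PolyTime v) : PolyTime fun c => (ts c).edge (s c) (u c) (v c) := by
  unfold Tokens.edge; fun_prop

@[fun_prop]
theorem regionStep {s : γ → ℕ} {X : γ → List Bool} (h : PolyTime ts) (hs : PolyTime s)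
    (hX : PolyTime X) : PolyTime fun c => (ts c).regionStep (s c) (X c) := by
  unfold Tokens.regionStep; fun_prop

theorem _root_.Tokens.length_iterate_regionStep (ts : Tokens) (s k : ℕ) :
    ((ts.regionStep s)^[k] ((List.range ts.states).map fun _ => true)).length = ts.states := by
  cases k with
  | zero => simp
  | succ k => rw [Function.iterate_succ_apply']; simp [Tokens.regionStep]

@[fun_prop]
theorem region {s : γ → ℕ} (h : PolyTime ts) (hs : PolyTime s) :
    PolyTime fun c => (ts c).region (s c) := by
  refine nat_iterate (n := fun c => (ts c).states) (f := fun c X => (ts c).regionStep (s c) X)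
    (B := fun c => 4 * size (ts c).states + 1) (by fun_prop) (by fun_prop) (by fun_prop)
    (((PolyBounded.const 4).mul h.states.size_bounded).add (.const 1)) fun c k hk => ?_
  refine (size_bits_le _).trans ?_
  rw [Tokens.length_iterate_regionStep]
  simp; omega

@[fun_prop]
theorem winning {s : γ → ℕ} (h : PolyTime ts) (hs : PolyTime s) :
    PolyTime fun c => (ts c).winning (s c) := by
  unfold Tokens.winning; fun_prop

@[fun_prop]
theorem losers (h : PolyTime ts) : PolyTime fun c => (ts c).losers := by
  unfold Tokens.losers; fun_prop

@[fun_prop]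
theorem commonDen (h : PolyTime ts) : PolyTime fun c => (ts c).commonDen := by
  unfold Tokens.commonDen; fun_prop

@[fun_prop]
theorem commonNum {k : γ → ℕ} (h : PolyTime ts) (hk : PolyTime k) :
    PolyTime fun c => (ts c).commonNum (k c) := by
  unfold Tokens.commonNum; fun_prop

@[fun_prop]
theorem signPart {s : Bool} (h : PolyTime ts) : PolyTime fun c => (ts c).signPart s := by
  unfold Tokens.signPart; fun_prop

@[fun_prop]
theorem pascalStep {n : γ → ℕ} {l : γ → List (List Bool)} (hn : PolyTime n) (hl : PolyTime l) :
    PolyTime fun c => Tokens.pascalStep (n c) (l c) := by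
  unfold Tokens.pascalStep; fun_prop

/-- An addition produces one digit more than its longer summand, so each round costs only one extra
digit although the values may double. -/
theorem _root_.Tokens.iterate_pascalStep_bound {n : ℕ} {l : List (List Bool)} {B : ℕ}
    (hl : ∀ x ∈ l, x.length ≤ B) (k : ℕ) :
    ((Tokens.pascalStep n)^[k] l).length ≤ max n l.length ∧
      ∀ x ∈ (Tokens.pascalStep n)^[k] l, x.length ≤ B + k := by
  induction k with
  | zero => simpa using hl
  | succ k ih =>
    rw [Function.iterate_succ_apply']
    set m := (Tokens.pascalStep n)^[k] l
    have h (i : ℕ) : (m.getD i []).length ≤ B + k := by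
      rw [List.getD_eq_getElem?_getD]
      rcases h : m[i]? with _ | x
      · simp
      · exact ih.2 x (List.mem_of_getElem? h)
    refine ⟨by simp [Tokens.pascalStep], fun x hx => ?_⟩
    obtain ⟨i, _, rfl⟩ := List.mem_map.1 hx
    rw [length_addBits]
    have h₁ := h i
    have h₂ := h (i + 1)
    omega

@[fun_prop]
theorem binomSum {n m : γ → ℕ} {l : γ → List (List Bool)} (hn : PolyTime n) (hm : PolyTime m)
    (hl : PolyTime l) : PolyTime fun c => Tokens.binomSum (n c) (m c) (l c) := by
  have : PolyTime fun c => (Tokens.pascalStep (n c))^[m c] (l c) := by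
    refine nat_iterate (f := fun c l => Tokens.pascalStep (n c) l)
      (B := fun c => (size (n c) + size (l c)) * ((4 * (size (l c) + size (m c)) + 1) + 1) + 1)
      hm hl (by fun_prop)
      (((hn.size_bounded.add hl.size_bounded).mul ((((PolyBounded.const 4).mul
        (hl.size_bounded.add hm.size_bounded)).add (.const 1)).add (.const 1))).add (.const 1))
      fun c k hk => ?_
    obtain ⟨h₁, h₂⟩ := Tokens.iterate_pascalStep_bound (n := n c) (l := l c) (B := size (l c))
      (fun x hx => (length_le_size x).trans (size_le_of_mem hx)) k
    have hsm := size_nat (m c)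
    have hsn := size_nat (n c)
    refine (size_list_le (B := 4 * (size (l c) + size (m c)) + 1) fun x hx => ?_).trans ?_
    · have := size_bits_le x
      have := h₂ x hx
      omega
    · gcongr
      have := length_le_size (l c)
      change ((Tokens.pascalStep (n c))^[k] (l c)).length ≤ _
      omega
  unfold Tokens.binomSum; fun_prop

@[fun_prop]
theorem part {s : Bool} (h : PolyTime ts) : PolyTime fun c => (ts c).part s := by
  unfold Tokens.part; fun_prop

@[fun_prop]
theorem positive (h : PolyTime ts) : PolyTime fun c => (ts c).positive := by
  unfold Tokens.positive; fun_prop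

@[fun_prop]
theorem exceeds (h : PolyTime ts) : PolyTime fun c => (ts c).exceeds := by
  unfold Tokens.exceeds; fun_prop

@[fun_prop]
theorem writeBits {l : γ → List Bool} (hl : PolyTime l) :
    PolyTime fun c => Tokens.writeBits (l c) := by
  unfold Tokens.writeBits; fun_prop

@[fun_prop]
theorem output (h : PolyTime ts) : PolyTime fun c => (ts c).output := by
  unfold Tokens.output; fun_prop

end PolyTime

/-! ### The tokens of an input -/

namespace Tokens

open Computability (Γ' encodeNat)

/-- The token of a natural number. -/
def natToken (m : ℕ) : List Γ' := (encodeNat m).map Γ'.bit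

theorem encNat_eq (m : ℕ) : encNat m = natToken m ++ [Γ'.comma] := rfl

theorem comma_notMem_map_bit (l : List Bool) : Γ'.comma ∉ l.map Γ'.bit := by simp

theorem comma_notMem_natToken (m : ℕ) : Γ'.comma ∉ natToken m := comma_notMem_map_bit _

theorem split_append {t : List Γ'} (ht : Γ'.comma ∉ t) (r : List Γ') :
    split (t ++ Γ'.comma :: r) = t :: split r := by
  induction t with
  | nil => rfl
  | cons a t ih =>
    have h₁ : (symIndex a == 2) = false := by
      have : a ≠ Γ'.comma := fun h => ht (by simp [h])
      rcases a with _ | ⟨_ | _⟩ | _ | _ | _ <;> first | rfl | exact absurd rfl this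
    have h₂ : split (a :: (t ++ Γ'.comma :: r)) = bif symIndex a == 2 then
        [] :: split (t ++ Γ'.comma :: r) else (a :: (split (t ++ Γ'.comma :: r)).headD []) ::
          (split (t ++ Γ'.comma :: r)).tail := rfl
    rw [List.cons_append, h₂, h₁, ih fun h => ht (by simp [h])]
    rfl

theorem split_flatMap {ι : Type*} {f : ι → List Γ'} (hf : ∀ i, Γ'.comma ∉ f i) (l : List ι)
    (r : List Γ') : split (l.flatMap (fun i => f i ++ [Γ'.comma]) ++ r) = l.map f ++ split r := by
  induction l with
  | nil => rfl
  | cons i l ih =>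
    have := split_append (hf i) (l.flatMap (fun i => f i ++ [Γ'.comma]) ++ r)
    simpa [ih] using this

/-- The tokens of a fraction. -/
def fractionTokens (q : Fraction) : Tokens :=
  [Γ'.bit (decide (q.num < 0)) :: natToken q.num.natAbs, natToken q.den]

theorem split_fractions (L : List Fraction) :
    split (L.flatMap Fraction.encode) = L.flatMap fractionTokens := by
  induction L with
  | nil => rfl
  | cons q L ih =>
    have h₁ := split_append (t := Γ'.bit (decide (q.num < 0)) :: natToken q.num.natAbs)
      (by simp [comma_notMem_natToken]) (encNat q.den ++ L.flatMap Fraction.encode)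
    have h₂ := split_append (comma_notMem_natToken q.den) (L.flatMap Fraction.encode)
    simp only [List.flatMap_cons, Fraction.encode, encNat_eq, fractionTokens, ← ih,
      List.append_assoc, List.cons_append, List.nil_append] at h₁ h₂ ⊢
    rw [h₁, h₂]

theorem fractions_getD (L : List Fraction) {k : ℕ} (hk : k < L.length) (d d' : List Γ') :
    (L.flatMap fractionTokens).getD (k + k) d = Γ'.bit (decide (L[k].num < 0)) ::
      natToken L[k].num.natAbs ∧
    (L.flatMap fractionTokens).getD (k + k + 1) d' = natToken L[k].den := by
  induction L generalizing k with
  | nil => simp at hk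
  | cons q L ih =>
    cases k with
    | zero => exact ⟨rfl, rfl⟩
    | succ k =>
      have := ih (k := k) (by simpa using hk)
      rw [show k + 1 + (k + 1) = k + k + 1 + 1 by ring]
      exact this

theorem bits_cons_bit (b : Bool) (l : List Γ') : bits (Γ'.bit b :: l) = b :: bits l := by
  cases b <;> simp [bits, symIndex]

theorem bits_map_bit (l : List Bool) : bits (l.map Γ'.bit) = l := by
  induction l with
  | nil => rfl
  | cons b l ih => rw [List.map_cons, bits_cons_bit, ih]

theorem bits_natToken (m : ℕ) : bits (natToken m) = encodeNat m := bits_map_bit _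

theorem bits_bra (l : List Γ') : bits (Γ'.bra :: l) = bits l := rfl

theorem bits_ket (l : List Γ') : bits (Γ'.ket :: l) = bits l := rfl

theorem cappedVal_eq (n : ℕ) (l : List Bool) : cappedVal n l = min n (bitVal l) := by
  induction l with
  | nil => simp [cappedVal]
  | cons b l ih =>
    simp only [cappedVal, List.foldr_cons] at ih ⊢
    rw [ih, bitVal_cons]
    cases b <;> simp <;> omega

theorem cappedVal_encodeNat {n m : ℕ} (h : m < n) : cappedVal n (encodeNat m) = m := by
  rw [cappedVal_eq, bitVal_encodeNat]
  omega

end Tokens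

namespace ResponsibilityInput

open Computability (Γ' encodeNat)
open Tokens

variable (x : ResponsibilityInput) (L : List Fraction)

open Classical in
/-- A row of the adjacency matrix. -/
noncomputable def rowToken (i : Fin x.n) : List Γ' :=
  (List.finRange x.n).map fun j => Γ'.bit (decide (x.ts.trans i j))

open Classical in
/-- The indicator vector of the bad states. -/
noncomputable def badToken : List Γ' :=
  (List.finRange x.n).map fun i => Γ'.bit (decide (i ∈ x.ts.bad))

/-- The tokens of the counterexample. -/
def ceTokens : Tokens :=
  match x.ce with
  | [] => []
  | a :: l => (Γ'.bra :: natToken a) :: l.map fun i : Fin x.n => natToken i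

/-- The fractions at the end of the input. -/
def fractions : List Fraction := (List.finRange x.n).map x.weight ++ L

/-- The tokens of the input, followed by the fractions `L`. -/
noncomputable def tokens : Tokens :=
  natToken x.n :: ((List.finRange x.n).map x.rowToken ++ (natToken x.ts.init :: x.badToken ::
    (x.ceTokens ++ ((Γ'.ket :: natToken x.state) :: (x.fractions L).flatMap fractionTokens))))

/-- The list `L` treats all problems at once: it is empty for positivity and computation, and holds
the threshold otherwise. -/
theorem split_encode : split (x.encode ++ L.flatMap Fraction.encode) = x.tokens L := by
  obtain ⟨a, l, hl⟩ := List.exists_cons_of_ne_nil x.isCounterexample.ne_nil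
  have hF : (List.finRange x.n).flatMap (fun k => (x.weight k).encode) ++
      L.flatMap Fraction.encode = (x.fractions L).flatMap Fraction.encode := by
    simp [fractions, List.flatMap_map]
  have hrow (i : Fin x.n) : Γ'.comma ∉ x.rowToken i := by simp [rowToken]
  have hbad : Γ'.comma ∉ x.badToken := by simp [badToken]
  have hbra : Γ'.comma ∉ Γ'.bra :: natToken a := by simp [comma_notMem_natToken]
  have hket : Γ'.comma ∉ Γ'.ket :: natToken x.state := by simp [comma_notMem_natToken]
  have e : x.encode ++ L.flatMap Fraction.encode =
      natToken x.n ++ Γ'.comma :: ((List.finRange x.n).flatMap (fun i => x.rowToken i ++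
        [Γ'.comma]) ++ (natToken x.ts.init ++ Γ'.comma :: (x.badToken ++ Γ'.comma ::
        ((Γ'.bra :: natToken a) ++ Γ'.comma :: (l.flatMap (fun i : Fin x.n => natToken i ++ [Γ'.comma]) ++
        ((Γ'.ket :: natToken x.state) ++ Γ'.comma ::
          (x.fractions L).flatMap Fraction.encode)))))) := by
    -- The coercion of the counterexample to natural numbers unfolds to a monadic bind.
    have hce (m : List (Fin x.n)) : (do let a ← m; pure (a : ℕ)) = m.map fun i : Fin x.n => (i : ℕ) := by
      induction m with
      | nil => rfl
      | cons a m ih => exact congrArg (List.cons (a : ℕ)) ih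
    rw [← hF]
    simp only [encode, hl, hce, encNat_eq, rowToken, badToken, List.map_cons, List.flatMap_cons,
      List.flatMap_map, List.append_assoc, List.cons_append, List.nil_append]
  rw [e, split_append (comma_notMem_natToken _), split_flatMap hrow,
    split_append (comma_notMem_natToken _), split_append hbad, split_append hbra,
    split_flatMap fun i => comma_notMem_natToken _, split_append hket, split_fractions]
  simp [tokens, ceTokens, hl]

theorem n_pos : 0 < x.n := x.state.pos

theorem tokens_getD_row (i : Fin x.n) : (x.tokens L).getD (i + 1) [] = x.rowToken i := by
  rw [tokens, List.getD_cons_succ, List.getD_append _ _ _ _ (by simp)]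
  simp [List.getD_eq_getElem?_getD]

theorem states_tokens : (x.tokens L).states = x.n := by
  rw [states, x.tokens_getD_row L ⟨0, x.n_pos⟩]
  simp [rowToken]

open Classical in
theorem adj_tokens (i j : Fin x.n) : (x.tokens L).adj i j = decide (x.ts.trans i j) := by
  rw [adj, tokens_getD_row]
  simp only [rowToken, List.getD_eq_getElem?_getD]
  simp
  cases decide (x.ts.trans i j) <;> rfl

theorem tokens_drop (k : ℕ) : (x.tokens L).drop (x.n + 1 + k) =
    (natToken x.ts.init :: x.badToken :: (x.ceTokens ++ ((Γ'.ket :: natToken x.state) ::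
      (x.fractions L).flatMap fractionTokens))).drop k := by
  rw [tokens, show x.n + 1 + k = x.n + k + 1 by ring, List.drop_succ_cons]
  rw [← List.drop_drop, List.drop_left' (by simp)]

theorem getD_eq_drop {ι : Type*} (l : List ι) (k m : ℕ) (d : ι) :
    l.getD (k + m) d = (l.drop k).getD m d := by
  simp [List.getD_eq_getElem?_getD]

open Classical in
theorem isBad_tokens (i : Fin x.n) : (x.tokens L).isBad i = decide (i ∈ x.ts.bad) := by
  rw [isBad, states_tokens, show x.n + 2 = x.n + 1 + 1 + 0 by ring, getD_eq_drop, tokens_drop]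
  simp only [badToken, List.getD_eq_getElem?_getD, List.drop_succ_cons, List.drop_zero]
  simp
  cases decide (i ∈ x.ts.bad) <;> rfl

/-- The closing bracket is the first symbol of the token after the path, and no path token starts
with it. The token of state 0 may be empty, where the default `blank` is harmless. -/
theorem pathTokens_tokens : (x.tokens L).pathTokens = x.ceTokens := by
  have hnat (m : ℕ) : (!(symIndex ((natToken m).headD .blank) == 4)) = true := by
    unfold natToken
    rcases encodeNat m with _ | ⟨b, l⟩
    · rfl
    · cases b <;> rfl
  rw [pathTokens, states_tokens, show x.n + 3 = x.n + 1 + 2 by ring, tokens_drop]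
  simp only [List.drop_succ_cons, List.drop_zero]
  rw [List.takeWhile_append_of_pos, List.takeWhile_cons_of_neg, List.append_nil]
  · simp [symIndex]
  · unfold ceTokens
    split
    · simp
    · intro t ht
      rcases List.mem_cons.1 ht with rfl | ht
      · rfl
      · obtain ⟨i, _, rfl⟩ := List.mem_map.1 ht
        exact hnat i

theorem path_tokens : (x.tokens L).path = x.ce.map fun i : Fin x.n => (i : ℕ) := by
  rw [path, pathTokens_tokens, states_tokens, ceTokens]
  split
  · next h => simp [h]
  · next a l h =>
    simp [h, bits_bra, bits_natToken, cappedVal_encodeNat]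

theorem statePos_tokens : (x.tokens L).statePos = x.n + 1 + (2 + x.ceTokens.length) := by
  rw [statePos, states_tokens, pathTokens_tokens]
  ring

theorem tokens_drop_statePos : (x.tokens L).drop (x.tokens L).statePos =
    (Γ'.ket :: natToken x.state) :: (x.fractions L).flatMap fractionTokens := by
  rw [statePos_tokens, tokens_drop, add_comm 2, List.drop_succ_cons, List.drop_succ_cons,
    List.drop_left]

theorem state_tokens : (x.tokens L).state = (x.state : ℕ) := by
  rw [Tokens.state, ← Nat.add_zero (x.tokens L).statePos, getD_eq_drop, tokens_drop_statePos,
    states_tokens, List.getD_cons_zero, bits_ket, bits_natToken, cappedVal_encodeNat x.state.2]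

theorem fraction_tokens {k : ℕ} (hk : k < (x.fractions L).length) :
    (x.tokens L).isNeg k = decide ((x.fractions L)[k].num < 0) ∧
    bitVal ((x.tokens L).num k) = (x.fractions L)[k].num.natAbs ∧
    bitVal ((x.tokens L).den k) = (x.fractions L)[k].den := by
  obtain ⟨h₁, h₂⟩ := fractions_getD (x.fractions L) hk [] []
  have hn : (x.tokens L).signedNum k = decide ((x.fractions L)[k].num < 0) ::
      encodeNat (x.fractions L)[k].num.natAbs := by
    rw [signedNum, show (x.tokens L).statePos + 1 + (k + k) =
      (x.tokens L).statePos + (k + k + 1) by ring, getD_eq_drop, tokens_drop_statePos,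
      List.getD_cons_succ, h₁, bits_cons_bit, bits_natToken]
  refine ⟨by rw [isNeg, hn]; rfl, by rw [num, hn]; exact bitVal_encodeNat _, ?_⟩
  rw [den, show (x.tokens L).statePos + 2 + (k + k) =
    (x.tokens L).statePos + (k + k + 1 + 1) by ring, getD_eq_drop, tokens_drop_statePos,
    List.getD_cons_succ, h₂, bits_natToken, bitVal_encodeNat]

end ResponsibilityInput

/-! ### Correctness of the algorithm -/

/-- Until it becomes stationary, the decreasing sequence loses an element in each round, which can
happen at most `Fintype.card α` times. Monotonicity of `f` is not needed. -/
theorem Finset.iterate_univ_fixed {α : Type*} [Fintype α] {f : Finset α → Finset α}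
    (hf : ∀ X, f X ⊆ X) :
    f (f^[Fintype.card α] Finset.univ) = f^[Fintype.card α] Finset.univ := by
  have key (k : ℕ) : f (f^[k] Finset.univ) = f^[k] Finset.univ ∨
      (f^[k] Finset.univ).card + k ≤ Fintype.card α := by
    induction k with
    | zero => exact Or.inr (by simp)
    | succ k ih =>
      rw [Function.iterate_succ_apply']
      by_cases h : f (f^[k] Finset.univ) = f^[k] Finset.univ
      · rw [h, h]; exact Or.inl rfl
      · have h₁ := Finset.card_lt_card ((hf _).ssubset_of_ne h)
        have h₂ := ih.resolve_left h
        exact Or.inr (by omega)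
  rcases key (Fintype.card α) with h | h
  · exact h
  · have : f^[Fintype.card α] Finset.univ = ∅ := Finset.card_eq_zero.1 (by omega)
    rw [this]
    exact Finset.subset_empty.1 (hf _)

theorem List.getD_map_range {α : Type*} (f : ℕ → α) (n k : ℕ) (d : α) :
    ((List.range n).map f).getD k d = if k < n then f k else d := by
  rw [List.getD_eq_getElem?_getD]
  split_ifs with h
  · simp [h]
  · simp [h]

/-- Pascal's rule, by induction on the number of rounds. Cutting the list at `n` loses nothing, as
all entries from there on are zero. -/
theorem Tokens.bitVal_pascalStep_iterate {n : ℕ} {l : List (List Bool)} (hl : l.length ≤ n)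
    (m k : ℕ) : bitVal (((Tokens.pascalStep n)^[m] l).getD k []) =
      ∑ j ∈ Finset.range (m + 1), m.choose j * bitVal (l.getD (k + j) []) := by
  have h₀ (k : ℕ) (hk : n ≤ k) : bitVal (l.getD k []) = 0 := by
    rw [List.getD_eq_default _ _ (hl.trans hk)]; rfl
  induction m generalizing k with
  | zero => simp
  | succ m ih =>
    rw [Function.iterate_succ_apply', Tokens.pascalStep, List.getD_map_range]
    split_ifs with hk
    · rw [bitVal_addBits, ih, ih, Finset.sum_range_succ' _ (m + 1), Finset.sum_range_succ' _ m,
        Finset.sum_range_succ (fun j => (m + 1).choose (j + 1) * bitVal (l.getD (k + (j + 1)) []))]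
      rw [Finset.sum_range_succ (fun j => m.choose j * bitVal (l.getD (k + 1 + j) []))]
      simp only [Nat.choose_succ_succ, add_mul, Finset.sum_add_distrib, Nat.choose_self,
        Nat.choose_zero_right, Nat.choose_succ_self, add_assoc, add_comm 1]
      ring
    · symm
      refine Finset.sum_eq_zero fun j _ => ?_
      rw [h₀ _ (by omega), mul_zero]

theorem Tokens.bitVal_binomSum {n : ℕ} {l : List (List Bool)} (hl : l.length ≤ n) (m : ℕ) :
    bitVal (Tokens.binomSum n m l) =
      ∑ j ∈ Finset.range (m + 1), m.choose j * bitVal (l.getD j []) := by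
  have := Tokens.bitVal_pascalStep_iterate hl m 0
  simp only [zero_add] at this
  rw [← this, Tokens.binomSum]
  cases (Tokens.pascalStep n)^[m] l <;> rfl

namespace ResponsibilityInput

open Tokens

variable (x : ResponsibilityInput) (L : List Fraction)

theorem any_path_tokens (u : Fin x.n) :
    ((x.tokens L).path.any fun w => w == u) = true ↔ u ∈ x.ce := by
  rw [path_tokens, List.any_eq_true]
  simp [Fin.val_inj]

/-- The default `x.n` is not a state, so reading past the end of the path matches nothing. -/
theorem path_getD_tokens (i : ℕ) (u : Fin x.n) : (x.tokens L).path.getD i x.n = u ↔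
    ∃ h : i < x.ce.length, u = x.ce[i] := by
  rw [path_tokens, List.getD_eq_getElem?_getD]
  by_cases h : i < x.ce.length
  · simp [h, Fin.ext_iff, eq_comm]
  · simp [h]
    omega

open Classical in
theorem edge_tokens (s u v : Fin x.n) :
    (x.tokens L).edge s u v = decide (x.ts.Edge x.ce {s} u v) := by
  have hs : ((u : ℕ) == (s : ℕ)) = decide (u = s) := by
    rw [Bool.eq_iff_iff]; simp [Fin.val_inj]
  have hp : ((x.tokens L).path.any fun w => w == u) = decide (u ∈ x.ce) := by
    rw [Bool.eq_iff_iff, any_path_tokens]; simp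
  rw [edge, hp, hs, adj_tokens]
  by_cases h : u ∈ x.ce ∧ u ≠ s
  · simp only [h, decide_true, decide_false, Bool.not_false, Bool.and_true, cond_true]
    rw [Bool.eq_iff_iff, List.any_eq_true, decide_eq_true_eq]
    simp only [List.mem_range, Bool.and_eq_true, beq_iff_eq, states_tokens, path_getD_tokens]
    constructor
    · rintro ⟨i, _, ⟨h₁, h₂⟩, h₃, h₄⟩
      exact Or.inl ⟨h.2, i, h₃, h₂, h₄⟩
    · rintro (⟨_, i, hi, h₁, h₂⟩ | ⟨_, h₁⟩)
      · exact ⟨i, by rw [path_tokens, List.length_map]; omega, ⟨by omega, h₁⟩, hi, h₂⟩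
      · exact absurd h₁ (by simp [h])
  · have : (decide (u ∈ x.ce) && !decide (u = s)) = false := by
      simpa using h
    rw [this, cond_false]
    refine decide_eq_decide.2 ⟨fun ht => Or.inr ⟨ht, ?_⟩, ?_⟩
    · by_contra hc
      exact h (by simpa using hc)
    · rintro (⟨h₁, i, hi, rfl, rfl⟩ | ⟨h₁, _⟩)
      · exact absurd ⟨List.getElem_mem _, h₁⟩ h
      · exact h₁

open Classical in
/-- One round of the computation of the safe region, on sets. -/
noncomputable def safeStep (s : Fin x.n) (X : Finset (Fin x.n)) : Finset (Fin x.n) :=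
  X.filter fun u => u ∉ x.ts.bad ∧
    ((∃ v, x.ts.Edge x.ce {s} u v) → ∃ v ∈ X, x.ts.Edge x.ce {s} u v)

open Classical in
theorem regionStep_iterate (s : Fin x.n) (k : ℕ) (u : Fin x.n) :
    (((x.tokens L).regionStep s)^[k] ((List.range x.n).map fun _ => true)).getD u false =
      decide (u ∈ (x.safeStep s)^[k] Finset.univ) := by
  have hany (p : ℕ → Bool) : (List.range x.n).any p = decide (∃ v : Fin x.n, p v = true) := by
    rw [Bool.eq_iff_iff, List.any_eq_true, decide_eq_true_eq]
    exact ⟨fun ⟨i, hi, h⟩ => ⟨⟨i, List.mem_range.1 hi⟩, h⟩,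
      fun ⟨v, h⟩ => ⟨v, List.mem_range.2 v.2, h⟩⟩
  induction k generalizing u with
  | zero => rw [Function.iterate_zero, id, List.getD_map_range]; simp
  | succ k ih =>
    rw [Function.iterate_succ_apply', Function.iterate_succ_apply', regionStep, states_tokens,
      List.getD_map_range, if_pos u.2, isBad_tokens, ih, hany, hany]
    simp only [edge_tokens, ih, safeStep, Finset.mem_filter]
    rw [Bool.eq_iff_iff]
    simp only [Bool.and_eq_true, Bool.or_eq_true, Bool.not_eq_true', decide_eq_true_eq,
      decide_eq_false_iff_not]
    constructor
    · rintro ⟨h₁, h₂, h₃⟩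
      refine ⟨h₂, h₁, fun h => ?_⟩
      obtain ⟨v, hv⟩ := h₃.resolve_right (not_not.2 h)
      exact ⟨v, hv.2, hv.1⟩
    · rintro ⟨h₁, h₂, h₃⟩
      refine ⟨h₂, h₁, ?_⟩
      by_cases h : ∃ v, x.ts.Edge x.ce {s} u v
      · obtain ⟨v, hv⟩ := h₃ h
        exact Or.inl ⟨v, hv.2, hv.1⟩
      · exact Or.inr h

open Classical in
-- The iteration yields the greatest safe region: it is a fixed point of `safeStep`, hence a safe
-- region, and by induction every round retains each safe region.
theorem winning_tokens (s : Fin x.n) :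
    (x.tokens L).winning s = decide (x.ts.IsWinning x.ce s) := by
  have hhead : (x.tokens L).path.headD x.n = (x.ts.init : ℕ) := by
    have h := x.isCounterexample
    have := h.init_eq h.length_pos
    rw [path_tokens, ← this, List.headD_eq_head?_getD, List.head?_map, List.head?_eq_getElem?,
      List.getElem?_eq_getElem h.length_pos]
    rfl
  rw [winning, states_tokens, hhead, region, states_tokens, regionStep_iterate]
  refine decide_eq_decide.2 ⟨fun h => ⟨_, h, ?_⟩, fun ⟨X, h₀, hX⟩ => ?_⟩
  · have hfix := Finset.iterate_univ_fixed (f := x.safeStep s) fun X => Finset.filter_subset _ _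
    rw [Fintype.card_fin] at hfix
    intro u hu
    have hu' : u ∈ (x.safeStep s)^[x.n] Finset.univ := hu
    rw [← hfix, safeStep, Finset.mem_filter] at hu'
    exact hu'.2
  · have key (k : ℕ) : ∀ u ∈ X, u ∈ (x.safeStep s)^[k] Finset.univ := by
      induction k with
      | zero => simp
      | succ k ih =>
        intro u hu
        rw [Function.iterate_succ_apply', safeStep, Finset.mem_filter]
        refine ⟨ih u hu, (hX u hu).1, fun h => ?_⟩
        obtain ⟨v, hv, hE⟩ := (hX u hu).2 h
        exact ⟨v, ih v hv, hE⟩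
    exact key _ _ h₀

open Classical in
/-- The states that win on their own. -/
noncomputable def winners : Finset (Fin x.n) := Finset.univ.filter fun s => x.ts.IsWinning x.ce s

open Classical in
theorem losers_tokens : (x.tokens L).losers = x.winnersᶜ.card := by
  have h (p : ℕ → Bool) : ((List.range x.n).filter p).length =
      (Finset.univ.filter fun i : Fin x.n => p i = true).card := by
    rw [← List.map_coe_finRange_eq_range, List.filter_map, List.length_map,
      ← List.toFinset_card_of_nodup ((List.nodup_finRange _).filter _)]
    congr 1
    ext i
    simp
  rw [losers, states_tokens, h]
  congr 1
  ext s
  simp [winners, winning_tokens]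

/-- The weights as a sequence of reals. -/
noncomputable def weightSeq (k : ℕ) : ℝ := if h : k < x.n then (x.weight ⟨k, h⟩).toReal else 0

theorem weight_tokens (k : Fin x.n) : (x.tokens L).isNeg k = decide ((x.weight k).num < 0) ∧
    bitVal ((x.tokens L).num k) = (x.weight k).num.natAbs ∧
    bitVal ((x.tokens L).den k) = (x.weight k).den := by
  have h := x.fraction_tokens L (k := k) (by simp [fractions]; omega)
  have e : (x.fractions L)[(k : ℕ)]'(by simp [fractions]; omega) = x.weight k := by
    simp only [fractions]
    rw [List.getElem_append_left (by simp)]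
    simp
  rwa [e] at h

theorem commonDen_tokens : bitVal (x.tokens L).commonDen = ∏ k, (x.weight k).den := by
  rw [commonDen, bitVal_prodBits, states_tokens, ← List.map_coe_finRange_eq_range, List.map_map,
    List.map_map, ← List.prod_ofFn, List.ofFn_eq_map]
  congr 1
  exact List.map_congr_left fun k _ => (x.weight_tokens L k).2.2

/-- The numerator is scaled by the other denominators, so no division is needed; multiplying by the
own denominator completes the product. -/
theorem commonNum_tokens (k : Fin x.n) : bitVal ((x.tokens L).commonNum k) * (x.weight k).den =
    (x.weight k).num.natAbs * bitVal (x.tokens L).commonDen := by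
  have h : (((List.range x.n).filter fun j => !(j == (k : ℕ))).map
      fun j => bitVal ((x.tokens L).den j)).prod * (x.weight k).den =
      bitVal (x.tokens L).commonDen := by
    have hnd : (List.range x.n).Nodup := List.nodup_range
    rw [commonDen, bitVal_prodBits, states_tokens, List.map_map, ← (x.weight_tokens L k).2.2]
    have e (p : List ℕ) (hp : p.Nodup) (f : ℕ → ℕ) : (p.map f).prod = ∏ j ∈ p.toFinset, f j :=
      (List.prod_toFinset f hp).symm
    rw [e _ (hnd.filter _), e _ hnd, mul_comm, ← Finset.mul_prod_erase _ _
      (List.mem_toFinset.2 (List.mem_range.2 k.2))]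
    refine congrArg _ (Finset.prod_congr ?_ fun _ _ => rfl)
    ext j
    simp [and_comm]
  rw [commonNum, bitVal_mulBits, bitVal_prodBits, states_tokens, List.map_map,
    (x.weight_tokens L k).2.1, mul_assoc]
  exact congrArg _ h

theorem commonDen_pos : 0 < bitVal (x.tokens L).commonDen := by
  rw [commonDen_tokens]
  exact Finset.prod_pos fun k _ => Nat.pos_of_ne_zero (x.weight k).den_ne_zero

theorem signPart_tokens (k : ℕ) :
    (bitVal (((x.tokens L).signPart false).getD k []) : ℝ) -
      bitVal (((x.tokens L).signPart true).getD k []) =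
    x.weightSeq k * bitVal (x.tokens L).commonDen := by
  rw [signPart, signPart, states_tokens, List.getD_map_range, List.getD_map_range, weightSeq]
  split_ifs with hk
  · have h₁ := x.commonNum_tokens L ⟨k, hk⟩
    have h₂ := (x.weight_tokens L ⟨k, hk⟩).1
    have h₃ : ((x.weight ⟨k, hk⟩).den : ℝ) ≠ 0 := by exact_mod_cast (x.weight ⟨k, hk⟩).den_ne_zero
    simp only at h₁ h₂
    have h₄ : (bitVal ((x.tokens L).commonNum k) : ℝ) * (x.weight ⟨k, hk⟩).den =
        ((x.weight ⟨k, hk⟩).num.natAbs : ℝ) * bitVal (x.tokens L).commonDen := by exact_mod_cast h₁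
    rw [h₂, Fraction.toReal, div_mul_eq_mul_div, eq_div_iff h₃]
    by_cases hneg : (x.weight ⟨k, hk⟩).num < 0
    · have : ((x.weight ⟨k, hk⟩).num : ℝ) = -((x.weight ⟨k, hk⟩).num.natAbs : ℝ) := by
        rw [Nat.cast_natAbs, abs_of_neg hneg]; simp
      generalize ((x.weight ⟨k, hk⟩).num.natAbs : ℝ) = a at this h₄
      simp [hneg, this, h₄]
    · have : ((x.weight ⟨k, hk⟩).num : ℝ) = ((x.weight ⟨k, hk⟩).num.natAbs : ℝ) := by
        rw [Nat.cast_natAbs, abs_of_nonneg (not_lt.1 hneg)]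
      generalize ((x.weight ⟨k, hk⟩).num.natAbs : ℝ) = a at this h₄
      simp [hneg, this, h₄]
  · simp

/-- Here game theory and arithmetic meet: the disjunction formula, scaled by the common denominator
and split by the sign of the weights. All three problems are read off from this identity. -/
theorem part_tokens : ((bitVal ((x.tokens L).part false) : ℝ) - bitVal ((x.tokens L).part true)) =
    x.optimisticResponsibility * bitVal (x.tokens L).commonDen := by
  classical
  have hp : (fun k : Fin (Fintype.card (Fin x.n)) =>
      (x.weight (Fin.cast (Fintype.card_fin x.n) k)).toReal) =
      fun k : Fin (Fintype.card (Fin x.n)) => x.weightSeq (k : ℕ) := by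
    funext k
    rw [weightSeq, dif_pos (by simpa using k.2)]
    rfl
  have hv (C : Finset (Fin x.n)) : x.ts.optimisticGame x.ce C =
      if ∃ s ∈ C, s ∈ x.winners then 1 else 0 := by
    rw [x.isCounterexample.optimisticGame_eq]
    simp [winners]
  have hlen (s : Bool) : ((x.tokens L).signPart s).length ≤ x.n := by
    simp [signPart, states_tokens]
  rw [optimisticResponsibility, hp]
  refine Eq.trans ?_ (congrArg (· * (bitVal (x.tokens L).commonDen : ℝ))
    (powerIndex_of_disjunction x.weightSeq x.winners (fun C => by convert hv C) x.state).symm)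
  have hw : x.state ∈ x.winners ↔ x.ts.IsWinning x.ce x.state := by simp [winners]
  simp only [part, state_tokens, winning_tokens, states_tokens, losers_tokens, hw]
  split_ifs with h
  · simp only [h, decide_true, cond_true, bitVal_binomSum (hlen _)]
    push_cast
    rw [← Finset.sum_sub_distrib, Finset.sum_mul]
    refine Finset.sum_congr rfl fun k _ => ?_
    rw [← mul_sub, signPart_tokens, mul_assoc]
  · simp [h]

end ResponsibilityInput

/-! ### The three problems. -/

theorem ResponsibilityInput.positive_iff (x : ResponsibilityInput) :
    (Tokens.split x.encode).positive = true ↔ 0 < x.optimisticResponsibility := by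
  have h₀ := x.split_encode []
  rw [List.flatMap_nil, List.append_nil] at h₀
  have h₁ := x.part_tokens []
  have h₂ : (0 : ℝ) < bitVal (x.tokens []).commonDen := by exact_mod_cast x.commonDen_pos []
  rw [h₀, Tokens.positive, ltBits_eq, decide_eq_true_eq, ← mul_pos_iff_of_pos_right h₂, ← h₁,
    sub_pos, Nat.cast_lt]

/-- Clear both positive denominators and move the negative part to the other side, so that only
natural numbers are compared. -/
theorem ThresholdInput.exceeds_iff (x : ThresholdInput) :
    (Tokens.split x.encode).exceeds = true ↔
      x.t.toReal < x.toResponsibilityInput.optimisticResponsibility := by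
  obtain ⟨x, t, ht, ht'⟩ := x
  have h₀ := x.split_encode [t]
  rw [List.flatMap_singleton] at h₀
  have h₁ := x.part_tokens [t]
  have h₂ : (0 : ℝ) < bitVal (x.tokens [t]).commonDen := by exact_mod_cast x.commonDen_pos [t]
  have h₃ : (0 : ℝ) < t.den := by exact_mod_cast Nat.pos_of_ne_zero t.den_ne_zero
  have hlen : x.n < (x.fractions [t]).length := by simp [ResponsibilityInput.fractions]
  have e : (x.fractions [t])[x.n] = t := by simp [ResponsibilityInput.fractions]
  obtain ⟨-, h₄, h₅⟩ := x.fraction_tokens [t] hlen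
  rw [e] at h₄ h₅
  -- As the threshold is nonnegative, its sign bit can be ignored.
  have h₆ : (t.num.natAbs : ℝ) = t.num := by
    have : 0 ≤ (t.num : ℝ) := by
      by_contra! h
      exact absurd ht (not_le.2 (div_neg_of_neg_of_pos h h₃))
    rw [Nat.cast_natAbs, abs_of_nonneg (by exact_mod_cast this)]
  change (Tokens.split (x.encode ++ t.encode)).exceeds = true ↔ t.toReal < x.optimisticResponsibility
  rw [h₀, Tokens.exceeds, x.states_tokens, ltBits_eq, decide_eq_true_eq, bitVal_addBits,
    bitVal_mulBits, bitVal_mulBits, bitVal_mulBits, h₄, h₅, Fraction.toReal, div_lt_iff₀ h₃,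
    ← mul_lt_mul_iff_left₀ h₂, mul_right_comm, ← h₁, sub_mul, lt_sub_iff_add_lt, ← h₆]
  norm_cast

/-- The optimistic responsibility as a fraction. -/
noncomputable def ResponsibilityInput.value (x : ResponsibilityInput) : Fraction where
  num := (bitVal ((x.tokens []).part false) : ℤ) - bitVal ((x.tokens []).part true)
  den := bitVal (x.tokens []).commonDen
  den_ne_zero := (x.commonDen_pos []).ne'

theorem ResponsibilityInput.value_toReal (x : ResponsibilityInput) :
    x.value.toReal = x.optimisticResponsibility := by
  have h₂ : (0 : ℝ) < bitVal (x.tokens []).commonDen := by exact_mod_cast x.commonDen_pos []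
  rw [Fraction.toReal, div_eq_iff (by exact h₂.ne')]
  refine Eq.trans ?_ (x.part_tokens [])
  simp [value]

theorem Tokens.writeBits_eq (l : List Bool) : Tokens.writeBits l = encNat (bitVal l) := by
  rw [Tokens.writeBits, encNat, encodeNat_bitVal]
  congr 2
  funext b
  cases b <;> rfl

theorem ResponsibilityInput.output_eq (x : ResponsibilityInput) :
    (Tokens.split x.encode).output = x.value.encode := by
  have h₀ := x.split_encode []
  rw [List.flatMap_nil, List.append_nil] at h₀
  rw [h₀, Tokens.output, Fraction.encode, ltBits_eq]
  by_cases h : bitVal ((x.tokens []).part false) < bitVal ((x.tokens []).part true)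
  · have e : x.value.num.natAbs =
        bitVal ((x.tokens []).part true) - bitVal ((x.tokens []).part false) := by
      simp only [value]; omega
    have e' : x.value.num < 0 := by simp only [value]; omega
    rw [decide_eq_true h, cond_true, Tokens.writeBits_eq, Tokens.writeBits_eq,
      bitVal_subBits h.le, e, decide_eq_true e']
    rfl
  · have e : x.value.num.natAbs =
        bitVal ((x.tokens []).part false) - bitVal ((x.tokens []).part true) := by
      simp only [value]; omega
    have e' : ¬ x.value.num < 0 := by simp only [value]; omega
    rw [decide_eq_false h, cond_false, Tokens.writeBits_eq, Tokens.writeBits_eq,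
      bitVal_subBits (not_lt.1 h), e, decide_eq_false e']
    rfl

theorem mainTheorem3 :
    -- positivity
    PolyTimeDecidable ResponsibilityInput.encode
      (fun x => 0 < x.optimisticResponsibility) ∧
    -- threshold
    PolyTimeDecidable ThresholdInput.encode
      (fun x => x.t.toReal < x.optimisticResponsibility) ∧
    -- computation
    ∃ value : ResponsibilityInput → Fraction,
      (∀ x, (value x).toReal = x.optimisticResponsibility) ∧
      PolyTimeComputable ResponsibilityInput.encode Fraction.encode value :=
  ⟨polyTimeDecidable_of_polyTime (F := fun l => (Tokens.split l).positive) (by fun_prop)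
      ResponsibilityInput.positive_iff,
    polyTimeDecidable_of_polyTime (F := fun l => (Tokens.split l).exceeds) (by fun_prop)
      ThresholdInput.exceeds_iff,
    ResponsibilityInput.value, ResponsibilityInput.value_toReal,
    polyTimeComputable_of_polyTime (F := fun l => (Tokens.split l).output) (by fun_prop)
      ResponsibilityInput.output_eq⟩
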